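/- A Minsky machine has finitely many control states (one of them initial) and finitely many counters, at least one, with values in $\mathbb N$; each control state carries one instruction: increment a counter and go to a given state; test a counter and, if it is positive, decrement it and go to one given state, otherwise leave it and go to another given state; or halt. It accepts $m\in\mathbb N$ if, started in the initial state with first counter $m$ and all other counters $0$, it reaches a halt instruction. A weighted automaton over a finite alphabet $\Gamma$ is a tuple $\mathcal A=(Q,\Gamma,\iota,\mu,F)$ with a finite set $Q$ of states, $\iota\in Q$, $F\subseteq Q$ and $\mu:Q\times\Gamma\times Q\to\{-\infty,0,1\}$. A run with label $w=a_1\cdots a_k\in\Gamma^+$ is a sequence $(q_0,a_1,q_1)\cdots(q_{k-1},a_k,q_k)$ with $q_0=\iota$, $q_k\in F$ and $\mu(q_{i-1},a_i,q_i)\neq-\infty$ for all $i$; its weight is the number of $i$ with $\mu(q_{i-1},a_i,q_i)=1$. The behaviour $\|\mathcal A\|:\Gamma^+\to\mathbb N\cup\{-\infty\}$ maps $w$ to the maximal weight of a run with label $w$ ($-\infty$ if there is none). For words $u,v\in\Sigma^*$, the convolution $u\otimes v$ is the word over $\Sigma_\#^2=(\Sigma\cup\{\#\})^2$ of length $\max(|u|,|v|)$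 whose $i$-th letter is the pair of the $i$-th letters of $u$ and $v$, where the shorter word is padded with $\#\notin\Sigma$. Write $\le_{\mathrm{pref}}$ for the prefix relation. There is an explicit construction that turns every Minsky machine $\mathcal M$ into a finite alphabet $\Sigma$ with distinct letters $\$,\Box,a$, a regular language $\mathrm{CT_{reg}}\subseteq(\Sigma\cdot\Box)^+$, weighted automata $\mathcal A$ and $\mathcal A_{\mathcal M}$ over $\Sigma$, and a weighted automaton $\mathcal B_{\mathcal M}$ over $\Sigma_\#^2$, such that the following hold. For $m\in\mathbb N$ and $u\in\Sigma^+$, write $P(m,u)$ for the statement $m=\max\{n\mid \$\Box(a\Box)^n\le_{\mathrm{pref}}u\}$ (which includes that the maximum exists). (a) $\|\mathcal A\|(u)\in\mathbb N$ for all $u\in\Sigma^+$; and for every $m\in\mathbb N$, $m$ is not accepted by $\mathcal M$ if and only if $\|\mathcal A\|(u)>\frac12|u|$ for all $u\in\mathrm{CT_{reg}}$ with $P(m,u)$. (b) $\|\mathcal A_{\mathcal M}\|(u)=\max(\lfloor\frac{|u|}2\rfloor+1,\|\mathcal A\|(u))$ for all $u\in\Sigma^+$. (c) For all $x\in(\Sigma_\#^2)^+$: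 if $x=u\otimes\$\Box(a\Box)^m$ with $u\in\Sigma^+$ and $m\in\mathbb N$, then $\|\mathcal B_{\mathcal M}\|(x)=\|\mathcal A\|(u)$ in case $u\in\mathrm{CT_{reg}}$ and $P(m,u)$, and $\|\mathcal B_{\mathcal M}\|(x)=\|\mathcal A_{\mathcal M}\|(u)$ otherwise; if $x$ is not of this form, then $\|\mathcal B_{\mathcal M}\|(x)=0$. (d) For $m\in\mathbb N$ and $u\in\Sigma^+$ put $r_{\mathcal M,m}(u)=\|\mathcal B_{\mathcal M}\|(u\otimes\$\Box(a\Box)^m)$. Then $r_{\mathcal M,m}(u)\in\mathbb N$, and for every $m\in\mathbb N$ the following are equivalent: (1) $m$ is not accepted by $\mathcal M$; (2) $\|\mathcal A_{\mathcal M}\|(u)=r_{\mathcal M,m}(u)$ for all $u\in\Sigma^+$. -/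

import Mathlib

/-! ### Minsky machines -/

/-- Instructions of a counter machine with counters `Fin (k + 1)` and control states `Fin (n + 1)`:
increment a counter; test a counter and, if it is positive, decrement it and go to the first state,
if it is zero, leave it unchanged and go to the second state; halt. -/
inductive MinskyInstr (k n : ℕ) : Type
  | inc (c : Fin (k + 1)) (q : Fin (n + 1)) : MinskyInstr k n
  | dec (c : Fin (k + 1)) (pos zero : Fin (n + 1)) : MinskyInstr k n
  | halt : MinskyInstr k n
  deriving DecidableEq

/-- A (deterministic) Minsky machine with an arbitrary positive number of counters and an arbitrary
positive number of control states; state `0` is initial, and counter `0` holds the input. -/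
structure MinskyMachine : Type where
  k : ℕ
  n : ℕ
  instr : Fin (n + 1) → MinskyInstr k n

namespace MinskyMachine

abbrev Counter (M : MinskyMachine) : Type := Fin (M.k + 1)

abbrev State (M : MinskyMachine) : Type := Fin (M.n + 1)

/-- Configurations: a control state and the values of the counters. -/
abbrev Config (M : MinskyMachine) : Type := M.State × (M.Counter → ℕ)

/-- The successor configuration (none, if the machine halts). -/
def step (M : MinskyMachine) (κ : M.Config) : Option M.Config :=
  match M.instr κ.1 with
  | .inc c q => some (q, Function.update κ.2 c (κ.2 c + 1))
  | .dec c pos zero =>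
      if κ.2 c = 0 then some (zero, κ.2) else some (pos, Function.update κ.2 c (κ.2 c - 1))
  | .halt => none

/-- The initial configuration on input `m`: counter `0` is `m`, all other counters are zero. -/
def initial (M : MinskyMachine) (m : ℕ) : M.Config := (0, Pi.single 0 m)

/-- `m` is accepted if the computation on input `m` reaches a halting instruction. -/
def Accepts (M : MinskyMachine) (m : ℕ) : Prop :=
  ∃ κ : M.Config, Relation.ReflTransGen (fun κ₁ κ₂ => M.step κ₁ = some κ₂) (M.initial m) κ ∧
    M.instr κ.1 = .halt

end MinskyMachine

/-! ### Weighted automata with weights `-∞`, `0`, `1` -/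

/-- A weighted automaton over the alphabet `α`: a finite set of states, an initial state, the
weight function (where `⊥` stands for `-∞`) and the (decidable) set of accepting states. -/
structure WeightedAutomaton (α : Type) : Type 1 where
  Q : Type
  [finiteQ : Finite Q]
  [decEqQ : DecidableEq Q]
  init : Q
  weight : Q → α → Q → WithBot (Fin 2)
  final : Q → Bool

attribute [instance] WeightedAutomaton.finiteQ WeightedAutomaton.decEqQ

namespace WeightedAutomaton

/-- `A.IsPath p ρ r`: the list `ρ` of transitions of weight `≠ -∞` leads from `p` to `r`. -/
def IsPath {α : Type} (A : WeightedAutomaton α) : A.Q → List (A.Q × α × A.Q) → A.Q → Prop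
  | p, [], r => p = r
  | p, t :: ρ, r => t.1 = p ∧ A.weight t.1 t.2.1 t.2.2 ≠ ⊥ ∧ A.IsPath t.2.2 ρ r

/-- Runs: nonempty paths from the initial state to an accepting state. -/
def IsRun {α : Type} (A : WeightedAutomaton α) (ρ : List (A.Q × α × A.Q)) : Prop :=
  ρ ≠ [] ∧ ∃ f, A.final f = true ∧ A.IsPath A.init ρ f

/-- The label of a run. -/
def label {α : Type} (A : WeightedAutomaton α) (ρ : List (A.Q × α × A.Q)) : List α :=
  ρ.map (fun t => t.2.1)

/-- The weight of a run: the number of its positions that carry a transition of weight `1`. -/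
def wt {α : Type} (A : WeightedAutomaton α) (ρ : List (A.Q × α × A.Q)) : ℕ :=
  ρ.countP (fun t => A.weight t.1 t.2.1 t.2.2 = 1)

/-- The weights of the runs with label `w`. -/
def runWeights {α : Type} (A : WeightedAutomaton α) (w : List α) : Set ℕ :=
  {n | ∃ ρ, A.IsRun ρ ∧ A.label ρ = w ∧ A.wt ρ = n}

open Classical in
/-- The behaviour: the maximal weight of a run with label `w` (`⊥`, i.e. `-∞`, if there is none).
The lemma `behaviour_eq_coe_iff` below confirms that it is a maximum. -/
noncomputable def behaviour {α : Type} (A : WeightedAutomaton α) (w : List α) : WithBot ℕ :=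
  if (A.runWeights w).Nonempty then ((sSup (A.runWeights w) : ℕ) : WithBot ℕ) else ⊥

theorem runWeights_bddAbove {α : Type} (A : WeightedAutomaton α) (w : List α) :
    BddAbove (A.runWeights w) := by
  refine ⟨w.length, ?_⟩
  rintro n ⟨ρ, -, rfl, rfl⟩
  simpa [label, wt] using List.countP_le_length

theorem behaviour_eq_coe_iff {α : Type} (A : WeightedAutomaton α) (w : List α) (n : ℕ) :
    A.behaviour w = (n : WithBot ℕ) ↔ IsGreatest (A.runWeights w) n := by
  unfold behaviour
  split_ifs with h
  · have hg : IsGreatest (A.runWeights w) (sSup (A.runWeights w)) :=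
      ⟨Nat.sSup_mem h (A.runWeights_bddAbove w), fun _ hx =>
        le_csSup (A.runWeights_bddAbove w) hx⟩
    constructor
    · intro e
      have e' : sSup (A.runWeights w) = n := by exact_mod_cast e
      exact e' ▸ hg
    · intro e
      rw [hg.unique e]
  · constructor
    · intro e
      exact absurd e (WithBot.bot_ne_coe)
    · intro e
      exact absurd ⟨n, e.1⟩ h

end WeightedAutomaton

/-- The convolution `u ⊗ v` of two words, over the alphabet `(Σ ∪ {#})²`; the padding symbol `#`
is `none`. -/
def convolution {α β : Type} : List α → List β → List (Option α × Option β)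
  | [], [] => []
  | x :: u, [] => (some x, none) :: convolution u []
  | [], y :: v => (none, some y) :: convolution [] v
  | x :: u, y :: v => (some x, some y) :: convolution u v

namespace MinskyMachine

/-! ### The alphabet and the language of potential computation traces

A configuration with control state `q` is written as the letter `q`, followed by a word of counter
letters, in any order, in which each counter occurs as often as its value says. A computation is
written as the concatenation of its configurations, with a `□` inserted after each letter. -/

/-- The alphabet `Σ` of the machine `M`. -/
inductive Letter (M : MinskyMachine) : Type
  | box : Letter M
  | state (q : M.State) : Letter M
  | counter (c : M.Counter) : Letter M
  deriving DecidableEq, Fintype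

/-- The letter `□`. -/
abbrev sqr (M : MinskyMachine) : M.Letter := .box

/-- The letter `$`, which stands for the initial state. -/
abbrev dollar (M : MinskyMachine) : M.Letter := .state 0

/-- The letter `a`, which stands for the input counter. -/
abbrev a (M : MinskyMachine) : M.Letter := .counter 0

/-- The word `$□(a□)^m`. -/
def initWord (M : MinskyMachine) (m : ℕ) : List M.Letter :=
  M.dollar :: M.sqr :: (List.replicate m [M.a, M.sqr]).flatten

/-- Does the instruction of state `q` test and decrement the counter `c`? -/
def tests (M : MinskyMachine) (q : M.State) (c : M.Counter) : Bool :=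
  match M.instr q with
  | .dec c' _ _ => decide (c' = c)
  | _ => false

/-- The next control state after `q`, if `pos` tells whether the counter that is tested by the
instruction of `q` (if any) is positive. -/
def nextState (M : MinskyMachine) (q : M.State) (pos : Bool) : Option M.State :=
  match M.instr q with
  | .inc _ p => some p
  | .dec _ p z => if pos then some p else some z
  | .halt => none

/-- States of the automaton for potential traces. In `block q first seen expectBox`, the control
state of the current configuration is `q`, the configuration is the first one iff `first`, the
counter tested by `q` has already occurred in it iff `seen`, and the next letter has to be `□`
iff `expectBox`. -/
inductive CTState (M : MinskyMachine) : Type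
  | start : CTState M
  | block (q : M.State) (first seen expectBox : Bool) : CTState M
  | dead : CTState M
  deriving DecidableEq, Fintype

def ctStep (M : MinskyMachine) : M.CTState → M.Letter → M.CTState
  | .start, .state q => if q = 0 then .block q true false true else .dead
  | .block q f s true, .box => .block q f s false
  | .block q f s false, .counter c =>
      if f = true ∧ c ≠ 0 then .dead else .block q f (s || M.tests q c) true
  | .block q _ s false, .state p =>
      if M.nextState q s = some p then .block p false false true else .dead
  | _, _ => .dead

def ctAccept (M : MinskyMachine) : M.CTState → Bool
  | .block q _ _ false => decide (M.instr q = .halt)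
  | _ => false

/-- The finite automaton for `CT_reg`: the word has the form of a halting computation (with all
counters but the input counter initially zero), in which the control states are correct relative
to the zero tests; the changes of the counter values are not checked. -/
def ctDFA (M : MinskyMachine) : DFA M.Letter M.CTState where
  step := M.ctStep
  start := .start
  accept := {s | M.ctAccept s = true}

/-- The language `CT_reg`. -/
def CTreg (M : MinskyMachine) : Language M.Letter := M.ctDFA.accepts

/-! ### The weighted automaton `A`

It reads a potential trace and guesses two consecutive configurations and a counter `c` whose value
in the second one is too small (`low = true`) or too large (`low = false`). A pair `x□` has weight
`0`, `1` or `2`; it is `1` except for the letters that take part in the comparison. -/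

inductive ErrState (M : MinskyMachine) : Type
  | idle : ErrState M
  | first (c : M.Counter) (low : Bool) (q : M.State) (seen pend : Bool) : ErrState M
  | second (c : M.Counter) (low pend : Bool) : ErrState M
  | done : ErrState M
  deriving DecidableEq, Fintype

/-- One plus the change (if `low`), or one minus the change (if not `low`), of counter `c` under
the instruction of `q`, where `pos` tells whether `c` is positive. -/
def delta (M : MinskyMachine) (c : M.Counter) (low : Bool) (q : M.State) (pos : Bool) : ℕ :=
  match M.instr q with
  | .inc c' _ => if c' = c then (if low then 2 else 0) else 1
  | .dec c' _ _ => if c' = c ∧ pos = true then (if low then 0 else 2) else 1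
  | .halt => 1

/-- The deterministic part of the transitions of `A`: successor state and weight. The flag `pend`
says that the following `□` has weight one. -/
def errNext (M : MinskyMachine) : M.ErrState → M.Letter → M.ErrState × Fin 2
  | .idle, .box => (.idle, 0)
  | .idle, _ => (.idle, 1)
  | .first c l q s pend, .box => (.first c l q s false, if pend then 1 else 0)
  | .first c l q s _, .counter c' =>
      if c' = c then (.first c l q true l, if l then 1 else 0) else (.first c l q s false, 1)
  | .first c l q s _, .state _ =>
      (.second c l (decide (M.delta c l q s = 2)), if M.delta c l q s = 0 then 0 else 1)
  | .second c l pend, .box => (.second c l false, if pend then 1 else 0)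
  | .second c l _, .counter c' =>
      if c' = c then (.second c l (!l), if l then 0 else 1) else (.second c l false, 1)
  | .second _ _ _, .state _ => (.done, 1)
  | .done, .box => (.done, 0)
  | .done, _ => (.done, 1)

/-- The nondeterministic guess: may `A` pass from `s` to `t` reading `x` in order to start a
comparison with the configuration that begins with `x`? -/
def errGuess (M : MinskyMachine) : M.ErrState → M.Letter → M.ErrState → Bool
  | .idle, .state q, .first _ _ q' false false => decide (q' = q)
  | _, _, _ => false

def errFinal (M : MinskyMachine) : M.ErrState → Bool
  | .first _ _ _ _ _ => false
  | _ => true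

/-- The weighted automaton `A`. -/
def autA (M : MinskyMachine) : WeightedAutomaton M.Letter where
  Q := M.ErrState
  init := .idle
  weight s x t :=
    if t = (M.errNext s x).1 then ((M.errNext s x).2 : Fin 2)
    else if M.errGuess s x t then ((1 : Fin 2) : WithBot (Fin 2)) else ⊥
  final := M.errFinal

end MinskyMachine

/-! ### The weighted automaton `A_M` -/

/-- States of the automaton that simulates an automaton with state set `Q` or counts half of the
letters of the input. -/
inductive HalfState (Q : Type) : Type
  | start : HalfState Q
  | sim (q : Q) : HalfState Q
  | odd : HalfState Q
  | even : HalfState Q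
  deriving DecidableEq, Fintype

instance {Q : Type} [Finite Q] : Finite (HalfState Q) := by
  have := Fintype.ofFinite Q
  infer_instance

def WeightedAutomaton.halfFinal {α : Type} (A : WeightedAutomaton α) : HalfState A.Q → Bool
  | .start => false
  | .sim q => A.final q
  | .odd => true
  | .even => true

/-- A weighted automaton for the maximum of `⌊|u|/2⌋ + 1` and the behaviour of `A`. -/
def WeightedAutomaton.maxHalf {α : Type} (A : WeightedAutomaton α) : WeightedAutomaton α where
  Q := HalfState A.Q
  init := .start
  weight s x t :=
    match s, t with
    | .start, .sim q => A.weight A.init x q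
    | .start, .odd => ((1 : Fin 2) : WithBot (Fin 2))
    | .sim p, .sim q => A.weight p x q
    | .odd, .even => ((1 : Fin 2) : WithBot (Fin 2))
    | .even, .odd => ((0 : Fin 2) : WithBot (Fin 2))
    | _, _ => ⊥
  final := A.halfFinal

namespace MinskyMachine

/-- The weighted automaton `A_M`. -/
def autAM (M : MinskyMachine) : WeightedAutomaton M.Letter := M.autA.maxHalf

/-! ### The weighted automaton `B_M` -/

/-- Status of the first track: it has to be a nonempty word, followed by padding. -/
inductive FirstTrack : Type
  | empty | running | ended | dead
  deriving DecidableEq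

instance : Fintype FirstTrack :=
  ⟨{.empty, .running, .ended, .dead}, fun x => by cases x <;> simp⟩

/-- Status of the second track: it has to be `$□(a□)^m`, followed by padding. -/
inductive SecondTrack : Type
  | start | dollar | full | a | ended | dead
  deriving DecidableEq

instance : Fintype SecondTrack :=
  ⟨{.start, .dollar, .full, .a, .ended, .dead}, fun x => by cases x <;> simp⟩

/-- Comparison of the tracks: the second track has so far been a prefix of the first; it has ended
as a prefix of the first and was not followed by `a` there; otherwise. -/
inductive Comparison : Type
  | same | longer | failed
  deriving DecidableEq

instance : Fintype Comparison :=
  ⟨{.same, .longer, .failed}, fun x => by cases x <;> simp⟩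

/-- States of the finite automaton that monitors both tracks; `ct` is the state of the automaton
for `CT_reg` on the first track. -/
structure Monitor (M : MinskyMachine) : Type where
  first : FirstTrack
  second : SecondTrack
  comparison : Comparison
  ct : M.CTState
  deriving DecidableEq, Fintype

def firstStep {β γ : Type} : FirstTrack → Option β × Option γ → FirstTrack
  | .empty, (some _, _) => .running
  | .running, (some _, _) => .running
  | .running, (none, some _) => .ended
  | .ended, (none, some _) => .ended
  | _, _ => .dead

def secondStep (M : MinskyMachine) : SecondTrack → Option M.Letter → SecondTrack
  | .start, some x => if x = M.dollar then .dollar else .dead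
  | .dollar, some x => if x = M.sqr then .full else .dead
  | .full, some x => if x = M.a then .a else .dead
  | .a, some x => if x = M.sqr then .full else .dead
  | .full, none => .ended
  | .ended, none => .ended
  | _, _ => .dead

def compareStep (M : MinskyMachine) :
    Comparison → Option M.Letter × Option M.Letter → Comparison
  | .same, (some x, some y) => if x = y then .same else .failed
  | .same, (some x, none) => if x = M.a then .failed else .longer
  | .same, (none, _) => .failed
  | .longer, _ => .longer
  | .failed, _ => .failed

def monitorInit (M : MinskyMachine) : M.Monitor := ⟨.empty, .start, .same, .start⟩

def monitorStep (M : MinskyMachine) (s : M.Monitor) (x : Option M.Letter × Option M.Letter) :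
    M.Monitor where
  first := firstStep s.first x
  second := M.secondStep s.second x.2
  comparison := M.compareStep s.comparison x
  ct :=
    match x.1 with
    | some y => M.ctStep s.ct y
    | none => s.ct

/-- The input is of the form `u ⊗ $□(a□)^m` with `u` nonempty. -/
def monitorValid (M : MinskyMachine) (s : M.Monitor) : Bool :=
  decide ((s.first = .running ∨ s.first = .ended) ∧ (s.second = .full ∨ s.second = .ended))

/-- The first track is in `CT_reg` and its maximal prefix in `$□(a□)*` is the second track
(for valid inputs). -/
def monitorTrace (M : MinskyMachine) (s : M.Monitor) : Bool :=
  M.ctAccept s.ct && decide (s.comparison ≠ .failed)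

/-- Simulation of an automaton on the first track; on padding the state is kept with weight `0`. -/
def padWeight {α : Type} (A : WeightedAutomaton α) (p : A.Q) (x : Option α) (q : A.Q) :
    WithBot (Fin 2) :=
  match x with
  | some y => A.weight p y q
  | none => if q = p then ((0 : Fin 2) : WithBot (Fin 2)) else ⊥

/-- `B_M` guesses which of the three cases applies and, on the first track, simulates `A` (first
summand) or `A_M` (second summand) or does nothing (third summand). -/
abbrev Mode (M : MinskyMachine) : Type := M.autA.Q ⊕ M.autAM.Q ⊕ Unit

def modeWeight (M : MinskyMachine) :
    M.Mode → Option M.Letter → M.Mode → WithBot (Fin 2)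
  | .inl p, x, .inl q => padWeight M.autA p x q
  | .inr (.inl p), x, .inr (.inl q) => padWeight M.autAM p x q
  | .inr (.inr _), _, .inr (.inr _) => ((0 : Fin 2) : WithBot (Fin 2))
  | _, _, _ => ⊥

/-- The initial state of the simulation of the same kind as a given mode. -/
def modeInit (M : MinskyMachine) : M.Mode → M.Mode
  | .inl _ => .inl M.autA.init
  | .inr (.inl _) => .inr (.inl M.autAM.init)
  | .inr (.inr _) => .inr (.inr ())

def modeFinal (M : MinskyMachine) (s : M.Monitor) : M.Mode → Bool
  | .inl q => M.monitorValid s && M.monitorTrace s && M.autA.final q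
  | .inr (.inl q) => M.monitorValid s && !M.monitorTrace s && M.autAM.final q
  | .inr (.inr _) => !M.monitorValid s

/-- The weighted automaton `B_M`; the state `none` is the initial one. -/
def autBM (M : MinskyMachine) : WeightedAutomaton (Option M.Letter × Option M.Letter) where
  Q := Option (M.Monitor × M.Mode)
  init := none
  weight s x t :=
    match s, t with
    | none, some (d', i') =>
        if d' = M.monitorStep M.monitorInit x then M.modeWeight (M.modeInit i') x.1 i' else ⊥
    | some (d, i), some (d', i') =>
        if d' = M.monitorStep d x then M.modeWeight i x.1 i' else ⊥
    | _, none => ⊥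
  final := fun s => s.elim false (fun d => M.modeFinal d.1 d.2)

/-- The function `r_{M,m}`: the behaviour of `B_M` with the second track fixed to `$□(a□)^m`. -/
noncomputable def r (M : MinskyMachine) (m : ℕ) (u : List M.Letter) : WithBot ℕ :=
  M.autBM.behaviour (convolution u (M.initWord m))

/-- `m = max {n | $□(a□)^n is a prefix of u}` -/
def IsMaxInit (M : MinskyMachine) (m : ℕ) (u : List M.Letter) : Prop :=
  IsGreatest {n : ℕ | M.initWord n <+: u} m

end MinskyMachine

/-!
A trace of `CT_reg` in which every counter changes as its instruction demands is a halting
computation, and the input of that computation is the `m` for which the trace starts with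
`$□(a□)^m` but not with `$□(a□)^(m + 1)`. So `m` is rejected iff each trace of `CT_reg` with this
maximal prefix contains two consecutive configurations between which some counter changes wrongly.

The automaton `A` compares weights with half of the length: away from the guessed comparison each
pair `x□` contributes `1`, and a comparison of a counter `c` in consecutive configurations shifts
the total by the difference between the actual and the required value of `c`, taken with the sign
that `A` guesses. Hence some run on a trace has weight above half of its length iff the trace
contains an error.

The behaviour of `A_M` is the maximum of that of `A` and the least integer above half of the
length, so `A` and `A_M` agree exactly at the words on which `A` exceeds half of the length. As
`B_M` simulates `A` on the traces with maximal prefix `$□(a□)^m` and `A_M` on all other words,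
`‖A_M‖ = r_{M,m}` says precisely that `A` exceeds half of the length on those traces.
-/

namespace WeightedAutomaton

variable {α β : Type}

/-! ### Weights of accepting paths -/

/-- The weights of the paths with label `w` from `p` to an accepting state, computed by recursion
on `w`; in contrast to `runWeights`, the word may be empty. -/
def weightsFrom (A : WeightedAutomaton α) : A.Q → List α → Set ℕ
  | p, [] => {n | A.final p = true ∧ n = 0}
  | p, x :: w => {n | ∃ (q : A.Q) (k : Fin 2) (m : ℕ),
      A.weight p x q = k ∧ m ∈ A.weightsFrom q w ∧ n = k + m}

theorem mem_weightsFrom_nil {A : WeightedAutomaton α} {p : A.Q} {n : ℕ} :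
    n ∈ A.weightsFrom p [] ↔ A.final p = true ∧ n = 0 :=
  Iff.rfl

theorem mem_weightsFrom_cons {A : WeightedAutomaton α} {p : A.Q} {x : α} {w : List α} {n : ℕ} :
    n ∈ A.weightsFrom p (x :: w) ↔ ∃ (q : A.Q) (k : Fin 2) (m : ℕ),
      A.weight p x q = k ∧ m ∈ A.weightsFrom q w ∧ n = k + m :=
  Iff.rfl

theorem wt_cons {A : WeightedAutomaton α} {p q : A.Q} {x : α} {k : Fin 2}
    (h : A.weight p x q = k) (ρ : List (A.Q × α × A.Q)) :
    A.wt ((p, x, q) :: ρ) = k + A.wt ρ := by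
  have coe_eq_one : ((k : WithBot (Fin 2)) = 1) ↔ k = 1 := WithBot.coe_inj (b := (1 : Fin 2))
  simp only [wt, List.countP_cons, h, coe_eq_one, decide_eq_true_eq]
  rw [add_comm]
  congr 1
  fin_cases k <;> rfl

theorem mem_weightsFrom_iff_exists_path {A : WeightedAutomaton α} {w : List α} {p : A.Q} {n : ℕ} :
    n ∈ A.weightsFrom p w ↔
      ∃ ρ f, A.final f = true ∧ A.IsPath p ρ f ∧ A.label ρ = w ∧ A.wt ρ = n := by
  induction w generalizing p n with
  | nil =>
    constructor
    · rintro ⟨hp, rfl⟩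
      exact ⟨[], p, hp, rfl, rfl, rfl⟩
    · rintro ⟨ρ, f, hf, hρ, hl, rfl⟩
      obtain rfl : ρ = [] := List.map_eq_nil_iff.1 hl
      obtain rfl : p = f := hρ
      exact ⟨hf, rfl⟩
  | cons x w ih =>
    constructor
    · rintro ⟨q, k, m, hk, hm, rfl⟩
      obtain ⟨ρ, f, hf, hρ, rfl, rfl⟩ := ih.1 hm
      exact ⟨(p, x, q) :: ρ, f, hf, ⟨rfl, hk ▸ WithBot.coe_ne_bot, hρ⟩, rfl, wt_cons hk ρ⟩
    · rintro ⟨_ | ⟨⟨p', x', q⟩, ρ⟩, f, hf, hρ, hl, rfl⟩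
      · cases hl
      · obtain ⟨rfl, hbot, hρ⟩ := hρ
        obtain ⟨rfl, rfl⟩ := List.cons.inj hl
        obtain ⟨k, hk⟩ := WithBot.ne_bot_iff_exists.1 hbot
        exact ⟨q, k, A.wt ρ, hk.symm, ih.2 ⟨ρ, f, hf, hρ, rfl, rfl⟩, wt_cons hk.symm ρ⟩

theorem runWeights_eq_weightsFrom (A : WeightedAutomaton α) {w : List α} (hw : w ≠ []) :
    A.runWeights w = A.weightsFrom A.init w := by
  ext n
  rw [mem_weightsFrom_iff_exists_path]
  constructor
  · rintro ⟨ρ, ⟨-, f, hf, hρ⟩, hl, hn⟩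
    exact ⟨ρ, f, hf, hρ, hl, hn⟩
  · rintro ⟨ρ, f, hf, hρ, rfl, hn⟩
    exact ⟨ρ, ⟨fun h => hw (by rw [h]; rfl), f, hf, hρ⟩, rfl, hn⟩

theorem weightsFrom_cons_of_unique {A : WeightedAutomaton α} {p q : A.Q} {x : α} {k : Fin 2}
    (h : ∀ (s : A.Q) (j : Fin 2), A.weight p x s = j ↔ s = q ∧ j = k) (w : List α) :
    A.weightsFrom p (x :: w) = ((k : ℕ) + ·) '' A.weightsFrom q w := by
  ext n
  constructor
  · rintro ⟨s, j, m, hj, hm, rfl⟩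
    obtain ⟨rfl, rfl⟩ := (h s j).1 hj
    exact ⟨m, hm, rfl⟩
  · rintro ⟨m, hm, rfl⟩
    exact ⟨q, k, m, (h q k).2 ⟨rfl, rfl⟩, hm, rfl⟩

/-! ### Behaviours -/

theorem behaviour_congr {A : WeightedAutomaton α} {B : WeightedAutomaton β} {u : List α}
    {v : List β} (h : A.runWeights u = B.runWeights v) : A.behaviour u = B.behaviour v := by
  rw [behaviour, behaviour, h]

theorem exists_behaviour_eq_coe {A : WeightedAutomaton α} {u : List α}
    (h : (A.runWeights u).Nonempty) : ∃ n : ℕ, A.behaviour u = n :=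
  ⟨_, if_pos h⟩

theorem behaviour_eq_max_of_runWeights_eq_insert {A : WeightedAutomaton α}
    {B : WeightedAutomaton β} {u : List α} {v : List β} {k : ℕ}
    (h : B.runWeights v = insert k (A.runWeights u)) :
    B.behaviour v = max (k : WithBot ℕ) (A.behaviour u) := by
  rcases (A.runWeights u).eq_empty_or_nonempty with hA | hA
  · have hbot : A.behaviour u = ⊥ := if_neg (Set.not_nonempty_iff_eq_empty.2 hA)
    rw [hbot, max_bot_right, behaviour_eq_coe_iff, h, hA, insert_empty_eq]
    exact isGreatest_singleton
  · obtain ⟨n, hn⟩ := exists_behaviour_eq_coe hA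
    have hmax : IsGreatest (B.runWeights v) (max k n) :=
      h ▸ ((A.behaviour_eq_coe_iff u n).1 hn).insert k
    rw [hn, (B.behaviour_eq_coe_iff v _).2 hmax]
    rfl

/-! ### Simulation of an automaton while ignoring part of the input -/

section Simulation

open MinskyMachine (padWeight)

theorem padWeight_none_eq_coe_iff {A : WeightedAutomaton α} {p q : A.Q} {k : Fin 2} :
    padWeight A p none q = k ↔ q = p ∧ k = 0 := by
  unfold padWeight
  split_ifs with h
  · simp only [h, true_and, WithBot.coe_inj, eq_comm]
  · simp only [h, false_and, WithBot.bot_ne_coe]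

/-- The automaton `B` reads its input deterministically with a monitor (states `D`, transitions
`δ`, accepting states `good`) and simulates `A` on the letters `π x ≠ none`. -/
structure Simulates {D : Type} (B : WeightedAutomaton β) (A : WeightedAutomaton α)
    (e : D → A.Q → B.Q) (δ : D → β → D) (π : β → Option α) (good : D → Bool) : Prop where
  weight_eq_coe_iff : ∀ d p x s (k : Fin 2), B.weight (e d p) x s = k ↔
    ∃ q, s = e (δ d x) q ∧ padWeight A p (π x) q = k
  final_eq : ∀ d p, B.final (e d p) = (good d && A.final p)

theorem Simulates.mem_weightsFrom_iff {D : Type} {B : WeightedAutomaton β} {A : WeightedAutomaton α}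
    {e : D → A.Q → B.Q} {δ : D → β → D} {π : β → Option α} {good : D → Bool}
    (h : Simulates B A e δ π good) {d : D} {p : A.Q} {w : List β} {n : ℕ} :
    n ∈ B.weightsFrom (e d p) w ↔
      good (w.foldl δ d) = true ∧ n ∈ A.weightsFrom p (w.filterMap π) := by
  induction w generalizing d p n with
  | nil => simp only [mem_weightsFrom_nil, h.final_eq, Bool.and_eq_true, List.foldl_nil,
      List.filterMap_nil, and_assoc]
  | cons x w ih =>
    have step : n ∈ B.weightsFrom (e d p) (x :: w) ↔ good (w.foldl δ (δ d x)) = true ∧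
        ∃ (q : A.Q) (k : Fin 2) (m : ℕ), padWeight A p (π x) q = k ∧
          m ∈ A.weightsFrom q (w.filterMap π) ∧ n = k + m := by
      simp only [mem_weightsFrom_cons, h.weight_eq_coe_iff]
      constructor
      · rintro ⟨_, k, m, ⟨q, rfl, hk⟩, hm, rfl⟩
        exact ⟨(ih.1 hm).1, q, k, m, hk, (ih.1 hm).2, rfl⟩
      · rintro ⟨hg, q, k, m, hk, hm, rfl⟩
        exact ⟨_, k, m, ⟨q, rfl, hk⟩, ih.2 ⟨hg, hm⟩, rfl⟩
    rw [step, List.foldl_cons]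
    refine and_congr_right fun _ => ?_
    cases hx : π x with
    | none =>
      rw [List.filterMap_cons_none hx]
      constructor
      · rintro ⟨q, k, m, hk, hm, rfl⟩
        obtain ⟨rfl, rfl⟩ := padWeight_none_eq_coe_iff.1 hk
        simpa using hm
      · exact fun hn => ⟨p, 0, n, padWeight_none_eq_coe_iff.2 ⟨rfl, rfl⟩, hn, by simp⟩
    | some y =>
      rw [List.filterMap_cons_some hx]
      rfl

end Simulation

/-! ### The maximum with half of the length -/

theorem maxHalf_simulates (A : WeightedAutomaton α) :
    Simulates A.maxHalf A (fun _ : Unit => HalfState.sim) (fun _ _ => ()) some fun _ => true where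
  weight_eq_coe_iff _ p x s k := by
    constructor
    · intro hk
      cases s with
      | sim q => exact ⟨q, rfl, hk⟩
      | _ => exact absurd hk WithBot.bot_ne_coe
    · rintro ⟨q, rfl, hk⟩
      exact hk
  final_eq _ _ := rfl

theorem weightsFrom_maxHalf_sim (A : WeightedAutomaton α) (p : A.Q) (w : List α) :
    A.maxHalf.weightsFrom (.sim p) w = A.weightsFrom p w := by
  ext n
  simpa only [List.filterMap_some, true_and] using A.maxHalf_simulates.mem_weightsFrom_iff (d := ())

theorem maxHalf_weight_odd_eq_coe_iff (A : WeightedAutomaton α) (x : α) (s : A.maxHalf.Q)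
    (k : Fin 2) :
    A.maxHalf.weight .odd x s = k ↔ s = .even ∧ k = 1 := by
  cases s <;> simp [maxHalf, eq_comm (a := k)]

theorem maxHalf_weight_even_eq_coe_iff (A : WeightedAutomaton α) (x : α) (s : A.maxHalf.Q)
    (k : Fin 2) :
    A.maxHalf.weight .even x s = k ↔ s = .odd ∧ k = 0 := by
  cases s <;> simp [maxHalf, eq_comm (a := k)]

theorem weightsFrom_maxHalf_odd_and_even (A : WeightedAutomaton α) (w : List α) :
    A.maxHalf.weightsFrom .odd w = {(w.length + 1) / 2} ∧
      A.maxHalf.weightsFrom .even w = {w.length / 2} := by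
  induction w with
  | nil => constructor <;> ext n <;> simp [mem_weightsFrom_nil, maxHalf, halfFinal]
  | cons x w ih =>
    constructor
    · rw [weightsFrom_cons_of_unique (A.maxHalf_weight_odd_eq_coe_iff x), ih.2, Set.image_singleton,
        Set.singleton_eq_singleton_iff, List.length_cons, Fin.val_one]
      omega
    · rw [weightsFrom_cons_of_unique (A.maxHalf_weight_even_eq_coe_iff x), ih.1,
        Set.image_singleton, Set.singleton_eq_singleton_iff, List.length_cons, Fin.val_zero,
        zero_add]

theorem runWeights_maxHalf (A : WeightedAutomaton α) {u : List α} (hu : u ≠ []) :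
    A.maxHalf.runWeights u = insert (u.length / 2 + 1) (A.runWeights u) := by
  rw [runWeights_eq_weightsFrom _ hu, runWeights_eq_weightsFrom _ hu]
  obtain ⟨x, w, rfl⟩ := List.exists_cons_of_ne_nil hu
  have hodd := (A.weightsFrom_maxHalf_odd_and_even w).1
  have half_add_one : (x :: w).length / 2 + 1 = ((1 : Fin 2) : ℕ) + (w.length + 1) / 2 := by
    rw [List.length_cons, Fin.val_one, add_comm]
  ext n
  rw [Set.mem_insert_iff, mem_weightsFrom_cons, mem_weightsFrom_cons, half_add_one]
  constructor
  · rintro ⟨s, k, m, hk, hm, rfl⟩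
    cases s with
    | sim q => exact .inr ⟨q, k, m, hk, A.weightsFrom_maxHalf_sim q w ▸ hm, rfl⟩
    | odd =>
      obtain rfl : 1 = k := WithBot.coe_injective hk
      rw [hodd, Set.mem_singleton_iff] at hm
      exact .inl (hm ▸ rfl)
    | _ => exact absurd hk WithBot.bot_ne_coe
  · rintro (rfl | ⟨q, k, m, hk, hm, rfl⟩)
    · exact ⟨.odd, 1, _, rfl, hodd ▸ rfl, rfl⟩
    · exact ⟨.sim q, k, m, hk, (A.weightsFrom_maxHalf_sim q w).symm ▸ hm, rfl⟩

theorem behaviour_maxHalf (A : WeightedAutomaton α) {u : List α} (hu : u ≠ []) :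
    A.maxHalf.behaviour u = max ((u.length / 2 + 1 : ℕ) : WithBot ℕ) (A.behaviour u) :=
  behaviour_eq_max_of_runWeights_eq_insert (A.runWeights_maxHalf hu)

end WeightedAutomaton

/-! ### Convolutions -/

section Convolution

variable {α β : Type}

/-- The word `y` over `Σ ∪ {#}` consists of `v` followed by padding symbols `#`. -/
def IsPadded (v : List α) (y : List (Option α)) : Prop :=
  ∃ k, y = v.map some ++ List.replicate k none

theorem isPadded_nil_right {v : List α} : IsPadded v [] ↔ v = [] := by
  simp only [IsPadded, List.nil_eq_append_iff, List.map_eq_nil_iff, List.replicate_eq_nil_iff,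
    exists_and_left, exists_eq, and_true]

theorem isPadded_none_cons {v : List α} {y : List (Option α)} :
    IsPadded v (none :: y) ↔ v = [] ∧ IsPadded [] y := by
  constructor
  · rintro ⟨k, hk⟩
    cases v with
    | nil =>
      cases k with
      | zero => cases hk
      | succ k => exact ⟨rfl, k, (List.cons.inj hk).2⟩
    | cons x v => cases hk
  · rintro ⟨rfl, k, rfl⟩
    exact ⟨k + 1, rfl⟩

theorem isPadded_some_cons {v : List α} {x : α} {y : List (Option α)} :
    IsPadded v (some x :: y) ↔ ∃ w, x :: w = v ∧ IsPadded w y := by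
  constructor
  · rintro ⟨k, hk⟩
    cases v with
    | nil => cases k <;> cases hk
    | cons z v =>
      obtain ⟨hxz, rfl⟩ := List.cons.inj hk
      cases hxz
      exact ⟨v, rfl, k, rfl⟩
  · rintro ⟨w, rfl, k, rfl⟩
    exact ⟨k, rfl⟩

theorem convolution_ne_nil {u : List α} (hu : u ≠ []) (v : List β) : convolution u v ≠ [] := by
  cases u <;> cases v <;> simp_all [convolution]

theorem filterMap_fst_convolution : ∀ (u : List α) (v : List β),
    (convolution u v).filterMap Prod.fst = u
  | [], [] => by simp [convolution]
  | x :: u, [] => by simp [convolution, filterMap_fst_convolution u []]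
  | [], y :: v => by simp [convolution, filterMap_fst_convolution [] v]
  | x :: u, y :: v => by simp [convolution, filterMap_fst_convolution u v]

theorem eq_convolution_iff {x : List (Option α × Option β)} {u : List α} {v : List β} :
    x = convolution u v ↔
      (none, none) ∉ x ∧ IsPadded u (x.map Prod.fst) ∧ IsPadded v (x.map Prod.snd) := by
  induction x generalizing u v with
  | nil => cases u <;> cases v <;> simp [convolution, isPadded_nil_right]
  | cons e x ih =>
    obtain ⟨_ | a, _ | b⟩ := e <;> cases u <;> cases v <;>
      simp [convolution, isPadded_none_cons, isPadded_some_cons, ih, and_assoc, and_left_comm]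

end Convolution

/-! ### Words with a `□` after each letter -/

namespace MinskyMachine

variable (M : MinskyMachine)

/-- The word with a `□` inserted after each letter. -/
def boxed (v : List M.Letter) : List M.Letter :=
  v.flatMap fun x => [x, M.sqr]

theorem boxed_nil : M.boxed [] = [] :=
  rfl

theorem boxed_cons (x : M.Letter) (v : List M.Letter) :
    M.boxed (x :: v) = x :: M.sqr :: M.boxed v :=
  rfl

theorem length_boxed (v : List M.Letter) : (M.boxed v).length = 2 * v.length := by
  induction v with
  | nil => rfl
  | cons x v ih => rw [boxed_cons, List.length_cons, List.length_cons, ih, List.length_cons]; ring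

theorem boxed_eq_nil_iff {v : List M.Letter} : M.boxed v = [] ↔ v = [] := by
  cases v <;> simp [boxed_nil, boxed_cons]

theorem boxed_prefix_boxed_iff {v w : List M.Letter} :
    M.boxed v <+: M.boxed w ↔ v <+: w := by
  induction v generalizing w with
  | nil => simp only [boxed_nil, List.nil_prefix]
  | cons x v ih =>
    cases w <;> simp [boxed_nil, boxed_cons, ih]

theorem boxed_append_singleton_prefix_boxed_iff {v w : List M.Letter} {x : M.Letter} :
    M.boxed v ++ [x] <+: M.boxed w ↔ v ++ [x] <+: w := by
  induction v generalizing w with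
  | nil => cases w <;> simp [boxed_nil, boxed_cons]
  | cons y v ih => cases w <;> simp [boxed_nil, boxed_cons, ih]

theorem initWord_eq_boxed (m : ℕ) : M.initWord m = M.boxed (M.dollar :: List.replicate m M.a) := by
  rw [boxed_cons, boxed, List.flatMap_replicate, initWord]

theorem isMaxInit_boxed_iff {m : ℕ} {v : List M.Letter} :
    M.IsMaxInit m (M.boxed v) ↔
      M.initWord m <+: M.boxed v ∧ ¬ M.initWord m ++ [M.a] <+: M.boxed v := by
  simp only [IsMaxInit, initWord_eq_boxed, boxed_append_singleton_prefix_boxed_iff,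
    boxed_prefix_boxed_iff, List.cons_append, ← List.replicate_succ']
  refine and_congr_right fun _ => ⟨fun hmax h => ?_, fun h n hn => ?_⟩
  · exact absurd (hmax h) (Nat.not_succ_le_self m)
  · by_contra! hmn
    obtain ⟨j, rfl⟩ := Nat.exists_eq_add_of_lt hmn
    refine h (List.IsPrefix.trans ((List.prefix_cons_inj _).2 ?_) hn)
    rw [add_right_comm, List.replicate_add (m + 1) j]
    exact List.prefix_append _ _

/-! ### The monitor -/

/-- The words `v` such that the second track is accepted if it continues with `v` from the given
status. -/
def secondRest : SecondTrack → Set (List M.Letter)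
  | .start => Set.range M.initWord
  | .dollar => Set.range fun m => M.sqr :: M.boxed (List.replicate m M.a)
  | .full => Set.range fun m => M.boxed (List.replicate m M.a)
  | .a => Set.range fun m => M.sqr :: M.boxed (List.replicate m M.a)
  | .ended => {[]}
  | .dead => ∅

theorem nil_mem_secondRest_iff {s : SecondTrack} :
    [] ∈ M.secondRest s ↔ s = .full ∨ s = .ended := by
  cases s <;> simp [secondRest, initWord, boxed_eq_nil_iff]

theorem cons_mem_secondRest_full_iff {x : M.Letter} {v : List M.Letter} :
    x :: v ∈ M.secondRest .full ↔ x = M.a ∧ v ∈ M.secondRest .a := by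
  constructor
  · rintro ⟨_ | m, hm⟩
    · cases hm
    · obtain ⟨rfl, rfl⟩ := List.cons.inj hm
      exact ⟨rfl, m, rfl⟩
  · rintro ⟨rfl, m, rfl⟩
    exact ⟨m + 1, rfl⟩

theorem cons_mem_secondRest_iff {s : SecondTrack} {x : M.Letter} {v : List M.Letter} :
    x :: v ∈ M.secondRest s ↔ v ∈ M.secondRest (M.secondStep s (some x)) := by
  cases s with
  | full =>
    rw [cons_mem_secondRest_full_iff]
    by_cases hx : x = M.a <;> simp [hx, secondStep, secondRest]
  | start =>
    rcases eq_or_ne x M.dollar with rfl | hx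
    · simp [secondStep, secondRest, initWord_eq_boxed, boxed_cons]
    · simp [secondStep, secondRest, initWord_eq_boxed, boxed_cons, hx, hx.symm]
  | dollar | a =>
    rcases eq_or_ne x M.sqr with rfl | hx
    · simp [secondStep, secondRest]
    · simp [secondStep, secondRest, hx, hx.symm]
  | ended => simp [secondStep, secondRest]
  | dead => simp [secondStep, secondRest]

theorem mem_secondRest_secondStep_none_iff {s : SecondTrack} {v : List M.Letter} :
    v ∈ M.secondRest (M.secondStep s none) ↔ v = [] ∧ [] ∈ M.secondRest s := by
  rw [nil_mem_secondRest_iff]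
  cases s <;> simp [secondStep, secondRest]

theorem foldl_secondStep_accepted_iff {s : SecondTrack} {y : List (Option M.Letter)} :
    y.foldl M.secondStep s = .full ∨ y.foldl M.secondStep s = .ended ↔
      ∃ v ∈ M.secondRest s, IsPadded v y := by
  induction y generalizing s with
  | nil => simp only [List.foldl_nil, isPadded_nil_right, exists_eq_right, nil_mem_secondRest_iff]
  | cons z y ih =>
    rw [List.foldl_cons, ih]
    cases z with
    | none =>
      simp only [mem_secondRest_secondStep_none_iff, isPadded_none_cons]
      constructor
      · rintro ⟨_, ⟨rfl, hs⟩, hy⟩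
        exact ⟨[], hs, rfl, hy⟩
      · rintro ⟨_, hs, rfl, hy⟩
        exact ⟨[], ⟨rfl, hs⟩, hy⟩
    | some x =>
      simp only [← cons_mem_secondRest_iff, isPadded_some_cons]
      constructor
      · rintro ⟨v, hv, hy⟩
        exact ⟨x :: v, hv, v, rfl, hy⟩
      · rintro ⟨_, hv, v, rfl, hy⟩
        exact ⟨v, hv, hy⟩

section FirstTrack

variable {β γ : Type}

theorem foldl_firstStep_dead (x : List (Option β × Option γ)) :
    x.foldl firstStep .dead = .dead := by
  induction x with
  | nil => rfl
  | cons _ _ ih => exact ih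

theorem foldl_firstStep_ended_iff {x : List (Option β × Option γ)} :
    x.foldl firstStep .ended = .running ∨ x.foldl firstStep .ended = .ended ↔
      (none, none) ∉ x ∧ IsPadded [] (x.map Prod.fst) := by
  induction x with
  | nil => simp [isPadded_nil_right]
  | cons e x ih =>
    obtain ⟨_ | a, _ | b⟩ := e <;>
      simp [firstStep, foldl_firstStep_dead, isPadded_none_cons, isPadded_some_cons, ih]

theorem foldl_firstStep_running_iff {x : List (Option β × Option γ)} :
    x.foldl firstStep .running = .running ∨ x.foldl firstStep .running = .ended ↔
      (none, none) ∉ x ∧ ∃ u, IsPadded u (x.map Prod.fst) := by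
  induction x with
  | nil => simp [isPadded_nil_right]
  | cons e x ih =>
    obtain ⟨_ | a, _ | b⟩ := e <;>
      simp [firstStep, foldl_firstStep_dead, foldl_firstStep_ended_iff, isPadded_none_cons,
        isPadded_some_cons, ih]

theorem foldl_firstStep_empty_iff {x : List (Option β × Option γ)} :
    x.foldl firstStep .empty = .running ∨ x.foldl firstStep .empty = .ended ↔
      (none, none) ∉ x ∧ ∃ u ≠ [], IsPadded u (x.map Prod.fst) := by
  obtain _ | ⟨⟨_ | a, b⟩, x⟩ := x
  · simp [isPadded_nil_right]
  · simp [firstStep, foldl_firstStep_dead, isPadded_none_cons]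
  · simp [firstStep, foldl_firstStep_running_iff, isPadded_some_cons]

end FirstTrack

theorem foldl_monitorStep (x : List (Option M.Letter × Option M.Letter)) (d : M.Monitor) :
    x.foldl M.monitorStep d =
      ⟨x.foldl firstStep d.first, (x.map Prod.snd).foldl M.secondStep d.second,
        x.foldl M.compareStep d.comparison, (x.filterMap Prod.fst).foldl M.ctStep d.ct⟩ := by
  induction x generalizing d with
  | nil => rfl
  | cons e x ih =>
    obtain ⟨_ | a, b⟩ := e
    all_goals exact ih _

theorem monitorValid_foldl_iff {x : List (Option M.Letter × Option M.Letter)} :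
    M.monitorValid (x.foldl M.monitorStep M.monitorInit) = true ↔
      ∃ (u : List M.Letter) (m : ℕ), u ≠ [] ∧ x = convolution u (M.initWord m) := by
  rw [monitorValid, decide_eq_true_eq]
  simp only [foldl_monitorStep, monitorInit, foldl_firstStep_empty_iff,
    foldl_secondStep_accepted_iff, eq_convolution_iff, secondRest, Set.exists_range_iff]
  constructor
  · rintro ⟨⟨hx, u, hu, hxu⟩, m, hxm⟩
    exact ⟨u, m, hu, hx, hxu, hxm⟩
  · rintro ⟨u, m, hu, hx, hxu, hxm⟩
    exact ⟨⟨hx, u, hu, hxu⟩, m, hxm⟩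

theorem foldl_compareStep_failed (x : List (Option M.Letter × Option M.Letter)) :
    x.foldl M.compareStep .failed = .failed := by
  induction x with
  | nil => rfl
  | cons _ _ ih => exact ih

theorem foldl_compareStep_longer (x : List (Option M.Letter × Option M.Letter)) :
    x.foldl M.compareStep .longer = .longer := by
  induction x with
  | nil => rfl
  | cons _ _ ih => exact ih

theorem foldl_compareStep_convolution_ne_failed_iff : ∀ {u v : List M.Letter},
    (convolution u v).foldl M.compareStep .same ≠ .failed ↔ v <+: u ∧ ¬ v ++ [M.a] <+: u
  | [], [] => by simp [convolution]
  | x :: u, [] => by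
    rcases eq_or_ne x M.a with rfl | hx
    · simp [convolution, compareStep, foldl_compareStep_failed]
    · simp [convolution, compareStep, hx, hx.symm, foldl_compareStep_longer]
  | [], y :: v => by simp [convolution, compareStep, foldl_compareStep_failed]
  | x :: u, y :: v => by
    rcases eq_or_ne x y with rfl | hxy
    · simpa [convolution, compareStep] using foldl_compareStep_convolution_ne_failed_iff
    · simp [convolution, compareStep, hxy, hxy.symm, foldl_compareStep_failed]

/-! ### Traces -/

theorem cons_mem_ctDFA_acceptsFrom_iff {s : M.CTState} {x : M.Letter} {w : List M.Letter} :
    x :: w ∈ M.ctDFA.acceptsFrom s ↔ w ∈ M.ctDFA.acceptsFrom (M.ctStep s x) :=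
  Iff.rfl

theorem notMem_ctDFA_acceptsFrom_dead (w : List M.Letter) :
    w ∉ M.ctDFA.acceptsFrom .dead := by
  induction w with
  | nil => exact Bool.false_ne_true
  | cons _ _ ih => exact ih

theorem ctStep_eq_dead_or_expects_box {s : M.CTState} (hs : ∀ q f e, s ≠ .block q f e true)
    (x : M.Letter) :
    M.ctStep s x = .dead ∨ x ≠ M.sqr ∧ ∃ q f e, M.ctStep s x = .block q f e true := by
  rcases s with _ | ⟨q, f, e, _ | _⟩ | _
  · cases x <;> simp only [ctStep, true_or]
    split_ifs <;> simp
  · cases x <;> simp only [ctStep, true_or] <;> split_ifs <;> simp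
  · exact absurd rfl (hs q f e)
  · exact .inl rfl

theorem exists_eq_boxed_of_mem_acceptsFrom : ∀ {u : List M.Letter} {s : M.CTState},
    (∀ q f e, s ≠ .block q f e true) → u ∈ M.ctDFA.acceptsFrom s →
      ∃ v, M.sqr ∉ v ∧ u = M.boxed v
  | [], _, _, _ => ⟨[], List.not_mem_nil, rfl⟩
  | x :: u, s, hs, hu => by
    rw [cons_mem_ctDFA_acceptsFrom_iff] at hu
    rcases M.ctStep_eq_dead_or_expects_box hs x with hx | ⟨hx, q, f, e, hstep⟩
    · exact absurd (hx ▸ hu) (M.notMem_ctDFA_acceptsFrom_dead u)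
    · rw [hstep] at hu
      match u, hu with
      | [], hu => exact absurd hu Bool.false_ne_true
      | .box :: u, hu =>
        obtain ⟨v, hv, rfl⟩ :=
          exists_eq_boxed_of_mem_acceptsFrom (s := .block q f e false) (by simp) hu
        exact ⟨x :: v, by simp [hv, hx.symm], rfl⟩
      | .state _ :: u, hu => exact absurd hu (M.notMem_ctDFA_acceptsFrom_dead u)
      | .counter _ :: u, hu => exact absurd hu (M.notMem_ctDFA_acceptsFrom_dead u)

theorem boxed_state_cons_mem_acceptsFrom_start_iff {q : M.State} {v : List M.Letter} :
    M.boxed (.state q :: v) ∈ M.ctDFA.acceptsFrom .start ↔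
      q = 0 ∧ M.boxed v ∈ M.ctDFA.acceptsFrom (.block 0 true false false) := by
  rw [boxed_cons, cons_mem_ctDFA_acceptsFrom_iff, cons_mem_ctDFA_acceptsFrom_iff]
  by_cases hq : q = 0
  · simp [hq, ctStep]
  · simp [hq, ctStep, notMem_ctDFA_acceptsFrom_dead]

theorem boxed_counter_cons_mem_acceptsFrom_iff {q : M.State} {f s : Bool} {c : M.Counter}
    {v : List M.Letter} :
    M.boxed (.counter c :: v) ∈ M.ctDFA.acceptsFrom (.block q f s false) ↔
      (f = true → c = 0) ∧
        M.boxed v ∈ M.ctDFA.acceptsFrom (.block q f (s || M.tests q c) false) := by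
  rw [boxed_cons, cons_mem_ctDFA_acceptsFrom_iff, cons_mem_ctDFA_acceptsFrom_iff]
  by_cases hc : f = true → c = 0
  · have hstep : M.ctStep (.block q f s false) (.counter c) = .block q f (s || M.tests q c) true :=
      if_neg (by tauto)
    rw [hstep, and_iff_right hc]
    rfl
  · have hstep : M.ctStep (.block q f s false) (.counter c) = .dead := if_pos (by tauto)
    rw [hstep]
    exact iff_of_false (M.notMem_ctDFA_acceptsFrom_dead _) fun h => hc h.1

theorem boxed_state_cons_mem_acceptsFrom_iff {p q : M.State} {f s : Bool} {v : List M.Letter} :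
    M.boxed (.state p :: v) ∈ M.ctDFA.acceptsFrom (.block q f s false) ↔
      M.nextState q s = some p ∧ M.boxed v ∈ M.ctDFA.acceptsFrom (.block p false false false) := by
  rw [boxed_cons, cons_mem_ctDFA_acceptsFrom_iff, cons_mem_ctDFA_acceptsFrom_iff]
  by_cases hp : M.nextState q s = some p
  · simp [hp, ctStep]
  · simp [hp, ctStep, notMem_ctDFA_acceptsFrom_dead]

theorem boxed_counters_append_mem_acceptsFrom_iff {q : M.State} {f s : Bool}
    {cs : List M.Counter} {v : List M.Letter} :
    M.boxed (cs.map .counter ++ v) ∈ M.ctDFA.acceptsFrom (.block q f s false) ↔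
      (f = true → ∀ c ∈ cs, c = 0) ∧
        M.boxed v ∈ M.ctDFA.acceptsFrom (.block q f (s || cs.any (M.tests q)) false) := by
  induction cs generalizing s with
  | nil => simp
  | cons c cs ih =>
    rw [List.map_cons, List.cons_append, boxed_counter_cons_mem_acceptsFrom_iff, ih,
      List.any_cons, Bool.or_assoc, ← and_assoc, ← imp_and, List.forall_mem_cons]

/-- A configuration as it occurs in a trace: the control state, followed by the counter letters in
the order in which they are written. -/
abbrev Block : Type :=
  M.State × List M.Counter

/-- The configuration that is written as the block `b`. -/
def blockConfig (b : M.Block) : M.Config :=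
  (b.1, fun c => b.2.count c)

/-- The word of a sequence of blocks, before the insertion of `□`. -/
def encode (t : List M.Block) : List M.Letter :=
  t.flatMap fun b => .state b.1 :: b.2.map .counter

/-- The control state of `b'` is the correct one after `b`. -/
def IsControlStep (b b' : M.Block) : Prop :=
  M.nextState b.1 (b.2.any (M.tests b.1)) = some b'.1

/-- The control states of the sequence `t` are those of a halting computation, relative to the
results of the zero tests. -/
def IsTrace (t : List M.Block) : Prop :=
  t.IsChain M.IsControlStep ∧ ∃ b ∈ t.getLast?, M.instr b.1 = .halt

theorem encode_cons (b : M.Block) (t : List M.Block) :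
    M.encode (b :: t) = .state b.1 :: (b.2.map .counter ++ M.encode t) :=
  rfl

theorem isTrace_singleton_iff {b : M.Block} : M.IsTrace [b] ↔ M.instr b.1 = .halt := by
  simp [IsTrace]

theorem isTrace_cons_cons_iff {b b' : M.Block} {t : List M.Block} :
    M.IsTrace (b :: b' :: t) ↔ M.IsControlStep b b' ∧ M.IsTrace (b' :: t) := by
  rw [IsTrace, IsTrace, List.isChain_cons_cons, List.getLast?_cons_cons, and_assoc]

theorem exists_eq_counters_append_encode {v : List M.Letter} (hv : M.sqr ∉ v) :
    ∃ (cs : List M.Counter) (t : List M.Block), v = cs.map .counter ++ M.encode t := by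
  induction v with
  | nil => exact ⟨[], [], rfl⟩
  | cons x v ih =>
    obtain ⟨hx, hv⟩ := not_or.1 (List.mem_cons.not.1 hv)
    obtain ⟨cs, t, rfl⟩ := ih hv
    cases x with
    | box => exact absurd rfl hx
    | state q => exact ⟨[], (q, cs) :: t, rfl⟩
    | counter c => exact ⟨c :: cs, t, rfl⟩

theorem boxed_encode_mem_acceptsFrom_iff {b : M.Block} {f : Bool} {t : List M.Block} :
    M.boxed (M.encode t) ∈
        M.ctDFA.acceptsFrom (.block b.1 f (b.2.any (M.tests b.1)) false) ↔
      M.IsTrace (b :: t) := by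
  induction t generalizing b f with
  | nil => exact decide_eq_true_iff.trans M.isTrace_singleton_iff.symm
  | cons b' t ih =>
    rw [encode_cons, boxed_state_cons_mem_acceptsFrom_iff,
      boxed_counters_append_mem_acceptsFrom_iff, Bool.false_or, ih, isTrace_cons_cons_iff]
    simp [IsControlStep]

theorem boxed_encode_cons_mem_CTreg_iff {b : M.Block} {t : List M.Block} :
    M.boxed (M.encode (b :: t)) ∈ M.CTreg ↔
      b.1 = 0 ∧ (∀ c ∈ b.2, c = 0) ∧ M.IsTrace (b :: t) := by
  obtain ⟨q, cs⟩ := b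
  rw [encode_cons]
  refine M.boxed_state_cons_mem_acceptsFrom_start_iff.trans (and_congr_right ?_)
  rintro rfl
  rw [boxed_counters_append_mem_acceptsFrom_iff, Bool.false_or,
    M.boxed_encode_mem_acceptsFrom_iff (b := (0, cs)), imp_iff_right rfl]

theorem exists_eq_boxed_encode_of_mem_CTreg {u : List M.Letter} (hu : u ∈ M.CTreg) :
    ∃ b t, u = M.boxed (M.encode (b :: t)) := by
  obtain ⟨v, hv, rfl⟩ := M.exists_eq_boxed_of_mem_acceptsFrom (by simp [ctDFA]) hu
  obtain ⟨_ | ⟨c, cs⟩, _ | ⟨b, t⟩, rfl⟩ := M.exists_eq_counters_append_encode hv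
  · exact absurd hu Bool.false_ne_true
  · exact ⟨b, t, rfl⟩
  all_goals exact absurd hu (M.notMem_ctDFA_acceptsFrom_dead _)

/-- The block of the initial configuration on input `m`. -/
def initialBlock (m : ℕ) : M.Block :=
  (0, List.replicate m 0)

theorem isMaxInit_boxed_encode_initialBlock (m : ℕ) (t : List M.Block) :
    M.IsMaxInit m (M.boxed (M.encode (M.initialBlock m :: t))) := by
  rw [isMaxInit_boxed_iff, initWord_eq_boxed, boxed_append_singleton_prefix_boxed_iff,
    boxed_prefix_boxed_iff, encode_cons, initialBlock, List.map_replicate, List.cons_append,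
    List.prefix_cons_inj, List.prefix_cons_inj, List.prefix_append_right_inj]
  refine ⟨List.prefix_append _ _, ?_⟩
  cases t <;> simp [encode]

theorem mem_CTreg_and_isMaxInit_iff {m : ℕ} {u : List M.Letter} :
    u ∈ M.CTreg ∧ M.IsMaxInit m u ↔ ∃ t, u = M.boxed (M.encode (M.initialBlock m :: t)) ∧
      M.IsTrace (M.initialBlock m :: t) := by
  constructor
  · rintro ⟨hu, hm⟩
    obtain ⟨⟨q, cs⟩, t, rfl⟩ := M.exists_eq_boxed_encode_of_mem_CTreg hu
    obtain ⟨rfl : q = 0, hcs, ht⟩ := M.boxed_encode_cons_mem_CTreg_iff.1 hu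
    obtain ⟨n, rfl⟩ : ∃ n, cs = List.replicate n 0 :=
      ⟨cs.length, List.eq_replicate_iff.2 ⟨rfl, hcs⟩⟩
    obtain rfl : m = n := hm.unique (M.isMaxInit_boxed_encode_initialBlock n t)
    exact ⟨t, rfl, ht⟩
  · rintro ⟨t, rfl, ht⟩
    exact ⟨M.boxed_encode_cons_mem_CTreg_iff.2
      ⟨rfl, fun _ hc => List.eq_of_mem_replicate hc, ht⟩,
      M.isMaxInit_boxed_encode_initialBlock m t⟩

theorem monitorTrace_foldl_convolution_iff {u : List M.Letter} {m : ℕ} :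
    M.monitorTrace ((convolution u (M.initWord m)).foldl M.monitorStep M.monitorInit) = true ↔
      u ∈ M.CTreg ∧ M.IsMaxInit m u := by
  rw [foldl_monitorStep, monitorTrace, Bool.and_eq_true, decide_eq_true_eq,
    filterMap_fst_convolution]
  refine and_congr_right fun hu => ?_
  obtain ⟨b, t, rfl⟩ := M.exists_eq_boxed_encode_of_mem_CTreg hu
  rw [isMaxInit_boxed_iff]
  exact M.foldl_compareStep_convolution_ne_failed_iff

/-! ### Computations -/

/-- The values of the counters in `b'` are the correct ones after `b`; `delta c true` is one plus
the change of `c`. -/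
def IsCounterStep (b b' : M.Block) : Prop :=
  ∀ c, b'.2.count c + 1 = b.2.count c + M.delta c true b.1 (decide (c ∈ b.2))

theorem delta_false_add_delta_true (c : M.Counter) (q : M.State) (pos : Bool) :
    M.delta c false q pos + M.delta c true q pos = 2 := by
  simp only [delta]
  cases M.instr q <;> dsimp only <;> split_ifs <;> simp_all only

theorem any_tests_of_instr_eq_dec {q p z : M.State} {c : M.Counter} (h : M.instr q = .dec c p z)
    (cs : List M.Counter) : cs.any (M.tests q) = decide (c ∈ cs) := by
  rw [← List.contains_eq_mem, List.contains_eq_any_beq]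
  congr
  funext c'
  rw [tests, h]
  exact (beq_eq_decide c c').symm

theorem step_blockConfig_eq_some_iff {b b' : M.Block} :
    M.step (M.blockConfig b) = some (M.blockConfig b') ↔
      M.IsControlStep b b' ∧ M.IsCounterStep b b' := by
  obtain ⟨q, cs⟩ := b
  unfold step IsControlStep IsCounterStep nextState delta
  cases hq : M.instr q with
  | halt => simp [blockConfig, hq]
  | inc c p =>
    simp only [blockConfig, hq, Option.some.injEq, Prod.mk.injEq, funext_iff,
      Function.update_apply]
    exact and_congr_right fun _ => forall_congr' fun c' => by grind
  | dec c p z =>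
    rw [M.any_tests_of_instr_eq_dec hq]
    by_cases hc : c ∈ cs
    · have hpos : 0 < cs.count c := List.count_pos_iff.2 hc
      simp only [blockConfig, hq, hc, hpos.ne', decide_true, if_true, if_false,
        Option.some.injEq, Prod.mk.injEq, funext_iff, Function.update_apply]
      exact and_congr_right fun _ => forall_congr' fun c' => by grind
    · have hzero : cs.count c = 0 := List.count_eq_zero.2 hc
      simp only [blockConfig, hq, hc, hzero, decide_false, if_true, Bool.false_eq_true, if_false,
        Option.some.injEq, Prod.mk.injEq, funext_iff]
      exact and_congr_right fun _ => forall_congr' fun c' => by grind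

theorem exists_blockConfig_eq (κ : M.Config) : ∃ b, M.blockConfig b = κ := by
  refine ⟨(κ.1, (Finsupp.equivFunOnFinite.symm κ.2).toMultiset.toList),
    Prod.ext rfl (funext fun c => ?_)⟩
  change List.count c _ = κ.2 c
  rw [← Multiset.coe_count, Multiset.coe_toList, Finsupp.count_toMultiset]
  rfl

theorem initial_eq_blockConfig (m : ℕ) : M.initial m = M.blockConfig (M.initialBlock m) := by
  refine Prod.ext rfl (funext fun c => ?_)
  simp only [initial, blockConfig, initialBlock, List.count_replicate, Pi.single_apply,
    beq_iff_eq]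
  exact if_congr eq_comm rfl rfl

theorem exists_reaches_halt_iff {b : M.Block} :
    (∃ κ : M.Config, Relation.ReflTransGen (fun κ₁ κ₂ => M.step κ₁ = some κ₂) (M.blockConfig b) κ ∧
      M.instr κ.1 = .halt) ↔ ∃ t, M.IsTrace (b :: t) ∧ (b :: t).IsChain M.IsCounterStep := by
  constructor
  · rintro ⟨κ, hκ, hhalt⟩
    generalize hb : M.blockConfig b = κ₀ at hκ
    induction hκ using Relation.ReflTransGen.head_induction_on generalizing b with
    | refl => exact ⟨[], M.isTrace_singleton_iff.2 (by rwa [← hb] at hhalt), .singleton b⟩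
    | @head _ κ₁ hstep _ ih =>
      obtain ⟨b', rfl⟩ := M.exists_blockConfig_eq κ₁
      obtain ⟨t, htrace, hchain⟩ := ih rfl
      obtain ⟨hcontrol, hcounter⟩ := M.step_blockConfig_eq_some_iff.1 (hb ▸ hstep)
      exact ⟨b' :: t, M.isTrace_cons_cons_iff.2 ⟨hcontrol, htrace⟩, .cons_cons hcounter hchain⟩
  · rintro ⟨t, htrace, hchain⟩
    induction t generalizing b with
    | nil => exact ⟨_, .refl, M.isTrace_singleton_iff.1 htrace⟩
    | cons b' t ih =>
      obtain ⟨hcontrol, htrace⟩ := M.isTrace_cons_cons_iff.1 htrace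
      obtain ⟨hcounter, hchain⟩ := List.isChain_cons_cons.1 hchain
      obtain ⟨κ, hκ, hhalt⟩ := ih htrace hchain
      exact ⟨κ, .head (M.step_blockConfig_eq_some_iff.2 ⟨hcontrol, hcounter⟩) hκ, hhalt⟩

theorem accepts_iff {m : ℕ} :
    M.Accepts m ↔ ∃ t, M.IsTrace (M.initialBlock m :: t) ∧
      (M.initialBlock m :: t).IsChain M.IsCounterStep := by
  rw [Accepts, initial_eq_blockConfig, exists_reaches_halt_iff]

/-! ### The automaton `A` on traces -/

theorem autA_weight_eq_coe_iff {s t : M.ErrState} {x : M.Letter} {k : Fin 2} :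
    M.autA.weight s x t = k ↔ t = (M.errNext s x).1 ∧ k = (M.errNext s x).2 ∨
      t ≠ (M.errNext s x).1 ∧ M.errGuess s x t = true ∧ k = 1 := by
  simp only [autA]
  split_ifs with hnext hguess
  · simp only [WithBot.coe_inj, hnext, ne_eq, not_true, false_and, or_false, true_and, eq_comm]
  · simp only [WithBot.coe_inj, hnext, hguess, ne_eq, not_false_eq_true, false_and, false_or,
      true_and, eq_comm]
  · simp only [WithBot.bot_ne_coe, hnext, hguess, Bool.false_eq_true, false_and, and_false,
      or_false]

theorem weightsFrom_autA_cons {s : M.ErrState} {x : M.Letter} (h : ∀ t, M.errGuess s x t = false)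
    (w : List M.Letter) : M.autA.weightsFrom s (x :: w) =
      (((M.errNext s x).2 : ℕ) + ·) '' M.autA.weightsFrom (M.errNext s x).1 w :=
  WeightedAutomaton.weightsFrom_cons_of_unique (fun t _ => M.autA_weight_eq_coe_iff.trans <|
    or_iff_left fun ht => Bool.false_ne_true ((h t).symm.trans ht.2.1)) w

theorem errGuess_sqr (s t : M.ErrState) : M.errGuess s M.sqr t = false := by
  cases s <;> rfl

theorem weightsFrom_autA_boxed_cons {s : M.ErrState} {x : M.Letter}
    (h : ∀ t, M.errGuess s x t = false) (v : List M.Letter) :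
    M.autA.weightsFrom s (M.boxed (x :: v)) =
      (((M.errNext s x).2 : ℕ) + (M.errNext (M.errNext s x).1 M.sqr).2 + ·) ''
        M.autA.weightsFrom (M.errNext (M.errNext s x).1 M.sqr).1 (M.boxed v) := by
  rw [boxed_cons, weightsFrom_autA_cons _ h, weightsFrom_autA_cons _ (M.errGuess_sqr _),
    Set.image_image]
  simp only [add_assoc]

theorem weightsFrom_autA_done_boxed {v : List M.Letter} (hv : M.sqr ∉ v) :
    M.autA.weightsFrom .done (M.boxed v) = {v.length} := by
  induction v with
  | nil => exact Set.ext fun n => and_iff_right rfl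
  | cons x v ih =>
    obtain ⟨hx, hv'⟩ := not_or.1 (List.mem_cons.not.1 hv)
    rw [weightsFrom_autA_boxed_cons _ (fun _ => rfl), List.length_cons]
    cases x with
    | box => exact absurd rfl hx
    | state | counter =>
      exact (congrArg (((1 + 0 : ℕ) + ·) '' ·) (ih hv')).trans (by simp [add_comm])

/-- The weight of the letter `c'` followed by `□` when the counter letters `c` are given the
weight `2` (if `double`) or `0` (otherwise). -/
def letterWeight (c : M.Counter) (double : Bool) (c' : M.Counter) : ℕ :=
  if c' = c then if double then 2 else 0 else 1

/-- The weight of a word of counter letters, each followed by `□`, with respect to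
`letterWeight`. -/
def countersWeight (c : M.Counter) (double : Bool) (cs : List M.Counter) : ℕ :=
  (cs.map (M.letterWeight c double)).sum

theorem countersWeight_cons (c : M.Counter) (double : Bool) (c' : M.Counter)
    (cs : List M.Counter) : M.countersWeight c double (c' :: cs) =
      M.letterWeight c double c' + M.countersWeight c double cs :=
  List.sum_cons

theorem countersWeight_true (c : M.Counter) (cs : List M.Counter) :
    M.countersWeight c true cs = cs.length + cs.count c := by
  induction cs with
  | nil => rfl
  | cons c' cs ih =>
    rw [countersWeight_cons, ih, List.length_cons, List.count_cons, letterWeight]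
    grind

theorem countersWeight_false_add_count (c : M.Counter) (cs : List M.Counter) :
    M.countersWeight c false cs + cs.count c = cs.length := by
  induction cs with
  | nil => rfl
  | cons c' cs ih =>
    rw [countersWeight_cons, List.length_cons, List.count_cons, letterWeight]
    grind

theorem weightsFrom_autA_second_counter_cons (c : M.Counter) (low : Bool) (c' : M.Counter)
    (v : List M.Letter) :
    M.autA.weightsFrom (.second c low false) (M.boxed (.counter c' :: v)) =
      (M.letterWeight c (!low) c' + ·) ''
        M.autA.weightsFrom (.second c low false) (M.boxed v) := by
  rw [weightsFrom_autA_boxed_cons _ (fun _ => rfl)]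
  by_cases hc : c' = c <;> cases low <;> simp [letterWeight, errNext, hc]

theorem weightsFrom_autA_second_state_cons (c : M.Counter) (low : Bool) (q : M.State)
    (v : List M.Letter) :
    M.autA.weightsFrom (.second c low false) (M.boxed (.state q :: v)) =
      (1 + ·) '' M.autA.weightsFrom .done (M.boxed v) :=
  M.weightsFrom_autA_boxed_cons (fun _ => rfl) v

theorem weightsFrom_autA_first_counter_cons (c : M.Counter) (low : Bool) (q : M.State)
    (seen : Bool) (c' : M.Counter) (v : List M.Letter) :
    M.autA.weightsFrom (.first c low q seen false) (M.boxed (.counter c' :: v)) =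
      (M.letterWeight c low c' + ·) ''
        M.autA.weightsFrom (.first c low q (seen || decide (c = c')) false) (M.boxed v) := by
  rw [weightsFrom_autA_boxed_cons _ (fun _ => rfl)]
  rcases eq_or_ne c' c with rfl | hc
  · cases low <;> simp [letterWeight, errNext]
  · simp [letterWeight, errNext, hc, hc.symm]

theorem weightsFrom_autA_first_state_cons (c : M.Counter) (low : Bool) (q : M.State)
    (seen : Bool) (p : M.State) (v : List M.Letter) :
    M.autA.weightsFrom (.first c low q seen false) (M.boxed (.state p :: v)) =
      (M.delta c low q seen + ·) '' M.autA.weightsFrom (.second c low false) (M.boxed v) := by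
  have hdelta : M.delta c low q seen ≤ 2 := by
    have hsum := M.delta_false_add_delta_true c q seen
    cases low <;> omega
  rw [weightsFrom_autA_boxed_cons _ (fun _ => rfl)]
  simp only [errNext]
  interval_cases M.delta c low q seen <;> rfl

theorem weightsFrom_autA_second_counters_append (c : M.Counter) (low : Bool)
    (cs : List M.Counter) (v : List M.Letter) :
    M.autA.weightsFrom (.second c low false) (M.boxed (cs.map .counter ++ v)) =
      (M.countersWeight c (!low) cs + ·) ''
        M.autA.weightsFrom (.second c low false) (M.boxed v) := by
  induction cs with
  | nil => simp [countersWeight]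
  | cons c' cs ih =>
    rw [List.map_cons, List.cons_append, weightsFrom_autA_second_counter_cons, ih,
      Set.image_image, countersWeight_cons]
    simp only [add_assoc]

theorem weightsFrom_autA_first_counters_append (c : M.Counter) (low : Bool) (q : M.State)
    (seen : Bool) (cs : List M.Counter) (v : List M.Letter) :
    M.autA.weightsFrom (.first c low q seen false) (M.boxed (cs.map .counter ++ v)) =
      (M.countersWeight c low cs + ·) ''
        M.autA.weightsFrom (.first c low q (seen || decide (c ∈ cs)) false) (M.boxed v) := by
  induction cs generalizing seen with
  | nil => simp [countersWeight]
  | cons c' cs ih =>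
    rw [List.map_cons, List.cons_append, weightsFrom_autA_first_counter_cons, ih,
      Set.image_image, countersWeight_cons]
    simp only [add_assoc, List.mem_cons, Bool.decide_or, Bool.or_assoc]

theorem sqr_notMem_counters_append_encode (cs : List M.Counter) (t : List M.Block) :
    M.sqr ∉ cs.map .counter ++ M.encode t := by
  simp [encode]

theorem weightsFrom_autA_second_boxed (c : M.Counter) (low : Bool) (cs : List M.Counter)
    (t : List M.Block) :
    M.autA.weightsFrom (.second c low false) (M.boxed (cs.map .counter ++ M.encode t)) =
      {M.countersWeight c (!low) cs + (M.encode t).length} := by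
  have rest : M.autA.weightsFrom (.second c low false) (M.boxed (M.encode t)) =
      {(M.encode t).length} := by
    cases t with
    | nil => exact Set.ext fun n => and_iff_right rfl
    | cons b t =>
      rw [encode_cons, weightsFrom_autA_second_state_cons,
        weightsFrom_autA_done_boxed _ (M.sqr_notMem_counters_append_encode _ _),
        Set.image_singleton, List.length_cons, add_comm]
  rw [weightsFrom_autA_second_counters_append, rest, Set.image_singleton]

theorem weightsFrom_autA_first_nil (c : M.Counter) (low : Bool) (q : M.State) (seen : Bool) :
    M.autA.weightsFrom (.first c low q seen false) [] = ∅ :=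
  Set.eq_empty_of_forall_notMem fun _ hn => Bool.false_ne_true hn.1

/-- The weight of the blocks `b`, `b'` in a run of `A` that guesses that the value of `c` in `b'`
is too small (`low = true`) or too large (`low = false`) to follow `b`. -/
def comparisonWeight (c : M.Counter) (low : Bool) (b b' : M.Block) : ℕ :=
  1 + M.countersWeight c low b.2 + M.delta c low b.1 (decide (c ∈ b.2)) +
    M.countersWeight c (!low) b'.2

/-- The guess `low = true` bounds the value of `c` in `b'` from below, `low = false` from above. -/
theorem isCounterStep_iff {b b' : M.Block} :
    M.IsCounterStep b b' ↔
      ∀ c low, M.comparisonWeight c low b b' ≤ b.2.length + b'.2.length + 2 := by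
  refine forall_congr' fun c => ?_
  have hdelta := M.delta_false_add_delta_true c b.1 (decide (c ∈ b.2))
  have hfirst := M.countersWeight_false_add_count c b.2
  have hsecond := M.countersWeight_false_add_count c b'.2
  simp only [comparisonWeight, Bool.forall_bool, Bool.not_false, Bool.not_true,
    countersWeight_true]
  omega

theorem weightsFrom_autA_idle_nil : M.autA.weightsFrom .idle [] = {0} :=
  Set.ext fun _ => and_iff_right rfl

theorem weightsFrom_autA_idle_counters_append (cs : List M.Counter) (v : List M.Letter) :
    M.autA.weightsFrom .idle (M.boxed (cs.map .counter ++ v)) =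
      (cs.length + ·) '' M.autA.weightsFrom .idle (M.boxed v) := by
  induction cs with
  | nil => simp
  | cons c cs ih =>
    rw [List.map_cons, List.cons_append, weightsFrom_autA_boxed_cons _ (fun _ => rfl)]
    refine (congrArg _ ih).trans ?_
    rw [Set.image_image, List.length_cons]
    refine Set.image_congr fun n _ => ?_
    change 1 + 0 + (cs.length + n) = cs.length + 1 + n
    ring

theorem mem_weightsFrom_autA_idle_state_cons_iff {q : M.State} {v : List M.Letter} {n : ℕ} :
    n ∈ M.autA.weightsFrom .idle (M.boxed (.state q :: v)) ↔
      n ∈ (1 + ·) '' M.autA.weightsFrom .idle (M.boxed v) ∨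
        ∃ c low, n ∈ (1 + ·) '' M.autA.weightsFrom (.first c low q false false) (M.boxed v) := by
  have after_sqr_idle : M.autA.weightsFrom .idle (M.sqr :: M.boxed v) =
      M.autA.weightsFrom .idle (M.boxed v) :=
    (M.weightsFrom_autA_cons (fun _ => rfl) _).trans (by simp [errNext])
  have after_sqr_first (c low) :
      M.autA.weightsFrom (.first c low q false false) (M.sqr :: M.boxed v) =
        M.autA.weightsFrom (.first c low q false false) (M.boxed v) :=
    (M.weightsFrom_autA_cons (fun _ => rfl) _).trans (by simp [errNext])
  simp only [← after_sqr_idle, ← after_sqr_first]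
  refine (WeightedAutomaton.mem_weightsFrom_cons (A := M.autA)).trans ?_
  constructor
  · rintro ⟨s, k, m, hk, hm, rfl⟩
    obtain ⟨rfl, rfl⟩ | ⟨-, hguess, rfl⟩ := M.autA_weight_eq_coe_iff.1 hk
    · exact .inl ⟨m, hm, rfl⟩
    · match s, hguess with
      | .first c low q' false false, hguess =>
        obtain rfl : q' = q := of_decide_eq_true hguess
        exact .inr ⟨c, low, m, hm, rfl⟩
  · rintro (⟨m, hm, rfl⟩ | ⟨c, low, m, hm, rfl⟩)
    · exact ⟨.idle, 1, m, M.autA_weight_eq_coe_iff.2 (.inl ⟨rfl, rfl⟩), hm, rfl⟩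
    · exact ⟨.first c low q false false, 1, m,
        M.autA_weight_eq_coe_iff.2 (.inr ⟨by simp [errNext], decide_eq_true rfl, rfl⟩), hm, rfl⟩

theorem mem_weightsFrom_autA_idle_encode_cons_iff {b : M.Block} {t : List M.Block} {n : ℕ} :
    n ∈ M.autA.weightsFrom .idle (M.boxed (M.encode (b :: t))) ↔
      n ∈ (1 + b.2.length + ·) '' M.autA.weightsFrom .idle (M.boxed (M.encode t)) ∨
        ∃ c low, n ∈ (1 + M.countersWeight c low b.2 + ·) ''
          M.autA.weightsFrom (.first c low b.1 (decide (c ∈ b.2)) false)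
            (M.boxed (M.encode t)) := by
  simp only [encode_cons, mem_weightsFrom_autA_idle_state_cons_iff,
    weightsFrom_autA_idle_counters_append, weightsFrom_autA_first_counters_append,
    Set.image_image, Bool.false_or, add_assoc]

theorem weightsFrom_autA_idle_encode_singleton (b : M.Block) :
    M.autA.weightsFrom .idle (M.boxed (M.encode [b])) = {1 + b.2.length} := by
  have boxed_encode_nil : M.boxed (M.encode []) = [] := rfl
  ext n
  simp only [mem_weightsFrom_autA_idle_encode_cons_iff, boxed_encode_nil, weightsFrom_autA_idle_nil,
    weightsFrom_autA_first_nil, Set.image_singleton, Set.image_empty, Set.mem_empty_iff_false,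
    exists_false, or_false, add_zero]

theorem mem_weightsFrom_autA_idle_encode_cons_cons_iff {b b' : M.Block} {t : List M.Block}
    {n : ℕ} : n ∈ M.autA.weightsFrom .idle (M.boxed (M.encode (b :: b' :: t))) ↔
      n ∈ (1 + b.2.length + ·) '' M.autA.weightsFrom .idle (M.boxed (M.encode (b' :: t))) ∨
        ∃ c low, n = M.comparisonWeight c low b b' + (M.encode t).length := by
  rw [mem_weightsFrom_autA_idle_encode_cons_iff]
  simp only [M.encode_cons b', weightsFrom_autA_first_state_cons, weightsFrom_autA_second_boxed,
    Set.image_singleton, Set.mem_singleton_iff, comparisonWeight, add_assoc]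

theorem length_encode_cons (b : M.Block) (t : List M.Block) :
    (M.encode (b :: t)).length = 1 + b.2.length + (M.encode t).length := by
  rw [encode_cons, List.length_cons, List.length_append, List.length_map]
  ring

theorem forall_weightsFrom_autA_le_iff {b : M.Block} {t : List M.Block} :
    (∀ n ∈ M.autA.weightsFrom .idle (M.boxed (M.encode (b :: t))),
      n ≤ (M.encode (b :: t)).length) ↔ (b :: t).IsChain M.IsCounterStep := by
  induction t generalizing b with
  | nil => simp [weightsFrom_autA_idle_encode_singleton, length_encode_cons]
  | cons b' t ih =>
    rw [List.isChain_cons_cons, ← ih, isCounterStep_iff, and_comm]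
    simp only [mem_weightsFrom_autA_idle_encode_cons_cons_iff, length_encode_cons, or_imp,
      forall_and, Set.forall_mem_image, forall_exists_index]
    refine and_congr (forall₂_congr fun n _ => by omega) ⟨fun h c low => ?_, ?_⟩
    · have := h _ c low rfl
      omega
    · rintro h n c low rfl
      have := h c low
      omega

theorem weightsFrom_autA_idle_nonempty (u : List M.Letter) :
    (M.autA.weightsFrom .idle u).Nonempty := by
  induction u with
  | nil => exact ⟨0, rfl, rfl⟩
  | cons x u ih =>
    obtain ⟨n, hn⟩ := ih
    have idle_next : (M.errNext .idle x).1 = .idle := by cases x <;> rfl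
    exact ⟨_, .idle, (M.errNext .idle x).2, n,
      M.autA_weight_eq_coe_iff.2 (.inl ⟨idle_next.symm, rfl⟩), hn, rfl⟩

theorem exists_autA_behaviour_eq_coe {u : List M.Letter} (hu : u ≠ []) :
    ∃ n : ℕ, M.autA.behaviour u = n :=
  WeightedAutomaton.exists_behaviour_eq_coe <|
    (M.autA.runWeights_eq_weightsFrom hu).symm ▸ M.weightsFrom_autA_idle_nonempty u

/-! ### The automaton `B_M` -/

theorem autBM_weight_some_eq_coe_iff {d : M.Monitor} {i : M.Mode}
    {x : Option M.Letter × Option M.Letter} {s : M.autBM.Q} {k : Fin 2} :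
    M.autBM.weight (some (d, i)) x s = k ↔
      ∃ j, s = some (M.monitorStep d x, j) ∧ M.modeWeight i x.1 j = k := by
  constructor
  · intro hk
    rcases s with _ | ⟨d', j⟩
    · exact absurd hk WithBot.bot_ne_coe
    · by_cases hd : d' = M.monitorStep d x
      · exact ⟨j, by rw [hd], (if_pos hd).symm.trans hk⟩
      · exact absurd ((if_neg hd).symm.trans hk) WithBot.bot_ne_coe
  · rintro ⟨j, rfl, hk⟩
    exact (if_pos rfl).trans hk

theorem autBM_weight_none_eq_coe_iff {x : Option M.Letter × Option M.Letter} {s : M.autBM.Q}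
    {k : Fin 2} : M.autBM.weight none x s = k ↔
      ∃ j, s = some (M.monitorStep M.monitorInit x, j) ∧
        M.modeWeight (M.modeInit j) x.1 j = k := by
  constructor
  · intro hk
    rcases s with _ | ⟨d', j⟩
    · exact absurd hk WithBot.bot_ne_coe
    · by_cases hd : d' = M.monitorStep M.monitorInit x
      · exact ⟨j, by rw [hd], (if_pos hd).symm.trans hk⟩
      · exact absurd ((if_neg hd).symm.trans hk) WithBot.bot_ne_coe
  · rintro ⟨j, rfl, hk⟩
    exact (if_pos rfl).trans hk

theorem modeInit_eq_of_modeWeight_eq_coe {i j : M.Mode} {x : Option M.Letter} {k : Fin 2}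
    (h : M.modeWeight i x j = k) : M.modeInit j = M.modeInit i := by
  rcases i with _ | _ | _ <;> rcases j with _ | _ | _ <;>
    first | rfl | exact absurd h WithBot.bot_ne_coe

theorem weightsFrom_autBM_none_cons (x : Option M.Letter × Option M.Letter)
    (w : List (Option M.Letter × Option M.Letter)) :
    M.autBM.weightsFrom none (x :: w) =
      {n | ∃ i, M.modeInit i = i ∧ n ∈ M.autBM.weightsFrom (some (M.monitorInit, i)) (x :: w)} := by
  ext n
  constructor
  · rintro ⟨s, k, m, hk, hm, rfl⟩
    obtain ⟨j, rfl, hj⟩ := M.autBM_weight_none_eq_coe_iff.1 hk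
    exact ⟨M.modeInit j, (M.modeInit_eq_of_modeWeight_eq_coe hj).symm, _, k, m,
      M.autBM_weight_some_eq_coe_iff.2 ⟨j, rfl, hj⟩, hm, rfl⟩
  · rintro ⟨i, hi, s, k, m, hk, hm, rfl⟩
    obtain ⟨j, rfl, hj⟩ := M.autBM_weight_some_eq_coe_iff.1 hk
    refine ⟨_, k, m, M.autBM_weight_none_eq_coe_iff.2 ⟨j, rfl, ?_⟩, hm, rfl⟩
    rwa [M.modeInit_eq_of_modeWeight_eq_coe hj, hi]

theorem autBM_simulates_autA :
    WeightedAutomaton.Simulates M.autBM M.autA (fun d p => some (d, .inl p)) M.monitorStep Prod.fst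
      fun d => M.monitorValid d && M.monitorTrace d where
  weight_eq_coe_iff d p x s k := by
    refine M.autBM_weight_some_eq_coe_iff.trans ⟨?_, ?_⟩
    · rintro ⟨q | _, rfl, hk⟩
      · exact ⟨q, rfl, hk⟩
      · exact absurd hk WithBot.bot_ne_coe
    · rintro ⟨q, rfl, hk⟩
      exact ⟨_, rfl, hk⟩
  final_eq _ _ := rfl

theorem autBM_simulates_autAM :
    WeightedAutomaton.Simulates M.autBM M.autAM (fun d p => some (d, .inr (.inl p))) M.monitorStep
      Prod.fst fun d => M.monitorValid d && !M.monitorTrace d where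
  weight_eq_coe_iff d p x s k := by
    refine M.autBM_weight_some_eq_coe_iff.trans ⟨?_, ?_⟩
    · rintro ⟨_ | q | _, rfl, hk⟩
      · exact absurd hk WithBot.bot_ne_coe
      · exact ⟨q, rfl, hk⟩
      · exact absurd hk WithBot.bot_ne_coe
    · rintro ⟨q, rfl, hk⟩
      exact ⟨_, rfl, hk⟩
  final_eq _ _ := rfl

theorem mem_weightsFrom_autBM_unit_iff {d : M.Monitor}
    {w : List (Option M.Letter × Option M.Letter)} {n : ℕ} :
    n ∈ M.autBM.weightsFrom (some (d, .inr (.inr ()))) w ↔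
      M.monitorValid (w.foldl M.monitorStep d) = false ∧ n = 0 := by
  induction w generalizing d with
  | nil => exact and_congr_left fun _ => Iff.of_eq (Bool.not_eq_true' _)
  | cons x w ih =>
    have hunique (s : M.autBM.Q) (k : Fin 2) : M.autBM.weight (some (d, .inr (.inr ()))) x s = k ↔
        s = some (M.monitorStep d x, .inr (.inr ())) ∧ k = 0 := by
      refine M.autBM_weight_some_eq_coe_iff.trans ⟨?_, ?_⟩
      · rintro ⟨_ | _ | _, rfl, hk⟩
        · exact absurd hk WithBot.bot_ne_coe
        · exact absurd hk WithBot.bot_ne_coe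
        · exact ⟨rfl, (WithBot.coe_injective hk).symm⟩
      · rintro ⟨rfl, rfl⟩
        exact ⟨_, rfl, rfl⟩
    rw [WeightedAutomaton.weightsFrom_cons_of_unique hunique]
    simpa using ih

theorem mem_autBM_runWeights_iff {x : List (Option M.Letter × Option M.Letter)} (hx : x ≠ [])
    {d : M.Monitor} (hd : x.foldl M.monitorStep M.monitorInit = d) {n : ℕ} :
    n ∈ M.autBM.runWeights x ↔
      M.monitorValid d = true ∧ M.monitorTrace d = true ∧
          n ∈ M.autA.weightsFrom M.autA.init (x.filterMap Prod.fst) ∨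
        M.monitorValid d = true ∧ M.monitorTrace d = false ∧
          n ∈ M.autAM.weightsFrom M.autAM.init (x.filterMap Prod.fst) ∨
        M.monitorValid d = false ∧ n = 0 := by
  obtain ⟨e, w, rfl⟩ := List.exists_cons_of_ne_nil hx
  have hA := M.autBM_simulates_autA.mem_weightsFrom_iff (d := M.monitorInit) (p := M.autA.init)
    (w := e :: w) (n := n)
  have hAM := M.autBM_simulates_autAM.mem_weightsFrom_iff (d := M.monitorInit) (p := M.autAM.init)
    (w := e :: w) (n := n)
  have hunit := M.mem_weightsFrom_autBM_unit_iff (d := M.monitorInit) (w := e :: w) (n := n)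
  rw [hd, Bool.and_eq_true, and_assoc] at hA
  rw [hd, Bool.and_eq_true, Bool.not_eq_true', and_assoc] at hAM
  rw [hd] at hunit
  rw [← hA, ← hAM, ← hunit, M.autBM.runWeights_eq_weightsFrom hx]
  refine (Set.ext_iff.1 (M.weightsFrom_autBM_none_cons e w) n).trans ⟨?_, ?_⟩
  · rintro ⟨_ | _ | _, hi, hn⟩
    · obtain rfl := Sum.inl_injective hi
      exact .inl hn
    · obtain rfl := Sum.inl_injective (Sum.inr_injective hi)
      exact .inr (.inl hn)
    · exact .inr (.inr hn)
  · rintro (hn | hn | hn)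
    exacts [⟨_, rfl, hn⟩, ⟨_, rfl, hn⟩, ⟨_, rfl, hn⟩]

theorem autBM_behaviour_of_trace {u : List M.Letter} {m : ℕ} (hu : u ≠ [])
    (h : u ∈ M.CTreg ∧ M.IsMaxInit m u) :
    M.autBM.behaviour (convolution u (M.initWord m)) = M.autA.behaviour u := by
  refine WeightedAutomaton.behaviour_congr (Set.ext fun n => ?_)
  rw [M.mem_autBM_runWeights_iff (convolution_ne_nil hu _) rfl,
    M.autA.runWeights_eq_weightsFrom hu, M.monitorValid_foldl_iff.2 ⟨u, m, hu, rfl⟩,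
    M.monitorTrace_foldl_convolution_iff.2 h, filterMap_fst_convolution]
  simp

theorem autBM_behaviour_of_not_trace {u : List M.Letter} {m : ℕ} (hu : u ≠ [])
    (h : ¬ (u ∈ M.CTreg ∧ M.IsMaxInit m u)) :
    M.autBM.behaviour (convolution u (M.initWord m)) = M.autAM.behaviour u := by
  refine WeightedAutomaton.behaviour_congr (Set.ext fun n => ?_)
  rw [M.mem_autBM_runWeights_iff (convolution_ne_nil hu _) rfl,
    M.autAM.runWeights_eq_weightsFrom hu, M.monitorValid_foldl_iff.2 ⟨u, m, hu, rfl⟩,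
    Bool.eq_false_iff.2 (mt M.monitorTrace_foldl_convolution_iff.1 h), filterMap_fst_convolution]
  simp

theorem autBM_behaviour_of_not_valid {x : List (Option M.Letter × Option M.Letter)} (hx : x ≠ [])
    (h : ¬ ∃ (u : List M.Letter) (m : ℕ), u ≠ [] ∧ x = convolution u (M.initWord m)) :
    M.autBM.behaviour x = 0 := by
  have runWeights_eq : M.autBM.runWeights x = {0} := by
    ext n
    rw [M.mem_autBM_runWeights_iff hx rfl, Bool.eq_false_iff.2 (mt M.monitorValid_foldl_iff.1 h)]
    simp
  refine (M.autBM.behaviour_eq_coe_iff x 0).2 ?_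
  rw [runWeights_eq]
  exact isGreatest_singleton

/-! ### Acceptance and behaviours -/

theorem autAM_behaviour {u : List M.Letter} (hu : u ≠ []) :
    M.autAM.behaviour u = max ((u.length / 2 + 1 : ℕ) : WithBot ℕ) (M.autA.behaviour u) :=
  M.autA.behaviour_maxHalf hu

theorem natCast_div_two_lt_natCast_iff {k n : ℕ} : (k : ℚ) / 2 < n ↔ k / 2 + 1 ≤ n := by
  rw [div_lt_iff₀ two_pos]
  norm_cast
  omega

theorem autAM_behaviour_eq_autA_behaviour_iff {u : List M.Letter} (hu : u ≠ []) :
    M.autAM.behaviour u = M.autA.behaviour u ↔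
      ∃ n : ℕ, M.autA.behaviour u = n ∧ (u.length : ℚ) / 2 < n := by
  obtain ⟨n, hn⟩ := M.exists_autA_behaviour_eq_coe hu
  simp only [M.autAM_behaviour hu, hn, max_eq_right_iff, Nat.cast_inj,
    exists_eq_left', natCast_div_two_lt_natCast_iff]
  exact WithBot.coe_le_coe

theorem exists_half_lt_autA_behaviour_iff {b : M.Block} {t : List M.Block} :
    (∃ n : ℕ, M.autA.behaviour (M.boxed (M.encode (b :: t))) = n ∧
        ((M.boxed (M.encode (b :: t))).length : ℚ) / 2 < n) ↔
      ¬ (b :: t).IsChain M.IsCounterStep := by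
  have hne : M.boxed (M.encode (b :: t)) ≠ [] := List.cons_ne_nil _ _
  obtain ⟨n, hn⟩ := M.exists_autA_behaviour_eq_coe hne
  have hmax := (M.autA.behaviour_eq_coe_iff _ n).1 hn
  rw [M.autA.runWeights_eq_weightsFrom hne] at hmax
  have bounded_iff : (b :: t).IsChain M.IsCounterStep ↔ n ≤ (M.encode (b :: t)).length :=
    M.forall_weightsFrom_autA_le_iff.symm.trans
      ⟨fun h => h n hmax.1, fun h _ hk => (hmax.2 hk).trans h⟩
  simp only [hn, Nat.cast_inj, exists_eq_left', natCast_div_two_lt_natCast_iff, length_boxed,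
    bounded_iff]
  omega

theorem not_accepts_iff {m : ℕ} : ¬ M.Accepts m ↔
    ∀ u ∈ M.CTreg, M.IsMaxInit m u →
      ∃ n : ℕ, M.autA.behaviour u = n ∧ (u.length : ℚ) / 2 < n := by
  rw [accepts_iff, not_exists]
  constructor
  · intro h u hu hmax
    obtain ⟨t, rfl, ht⟩ := M.mem_CTreg_and_isMaxInit_iff.1 ⟨hu, hmax⟩
    exact M.exists_half_lt_autA_behaviour_iff.2 fun hchain => h t ⟨ht, hchain⟩
  · rintro h t ⟨ht, hchain⟩
    obtain ⟨hu, hmax⟩ := M.mem_CTreg_and_isMaxInit_iff.2 ⟨t, rfl, ht⟩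
    exact M.exists_half_lt_autA_behaviour_iff.1 (h _ hu hmax) hchain

theorem exists_r_eq_coe (m : ℕ) {u : List M.Letter} (hu : u ≠ []) : ∃ n : ℕ, M.r m u = n := by
  obtain ⟨n, hn⟩ := M.exists_autA_behaviour_eq_coe hu
  by_cases h : u ∈ M.CTreg ∧ M.IsMaxInit m u
  · exact ⟨n, (M.autBM_behaviour_of_trace hu h).trans hn⟩
  · refine ⟨max (u.length / 2 + 1) n, (M.autBM_behaviour_of_not_trace hu h).trans ?_⟩
    rw [M.autAM_behaviour hu, hn]
    rfl

theorem exists_ne_nil_eq_boxed_of_mem_CTreg {u : List M.Letter} (hu : u ∈ M.CTreg) :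
    ∃ v, v ≠ [] ∧ u = M.boxed v := by
  obtain ⟨b, t, rfl⟩ := M.exists_eq_boxed_encode_of_mem_CTreg hu
  exact ⟨_, List.cons_ne_nil _ _, rfl⟩

theorem not_accepts_iff_behaviour_eq {m : ℕ} : ¬ M.Accepts m ↔
    ∀ u : List M.Letter, u ≠ [] → M.autAM.behaviour u = M.r m u := by
  rw [not_accepts_iff]
  constructor
  · intro h u hu
    by_cases htrace : u ∈ M.CTreg ∧ M.IsMaxInit m u
    · exact ((M.autAM_behaviour_eq_autA_behaviour_iff hu).2 (h u htrace.1 htrace.2)).trans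
        (M.autBM_behaviour_of_trace hu htrace).symm
    · exact (M.autBM_behaviour_of_not_trace hu htrace).symm
  · intro h u hu hmax
    obtain ⟨v, hv, rfl⟩ := M.exists_ne_nil_eq_boxed_of_mem_CTreg hu
    have hne := M.boxed_eq_nil_iff.not.2 hv
    exact (M.autAM_behaviour_eq_autA_behaviour_iff hne).1
      ((h _ hne).trans (M.autBM_behaviour_of_trace hne ⟨hu, hmax⟩))

end MinskyMachine

theorem mainTheorem8 (M : MinskyMachine) :
    -- `CT_reg` is a regular subset of `(Σ·□)⁺`
    M.CTreg.IsRegular ∧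
    (∀ u ∈ M.CTreg, ∃ v : List M.Letter, v ≠ [] ∧ u = v.flatMap (fun x => [x, M.sqr])) ∧
    -- the behaviour of `A` takes values in `ℕ`, and it characterises acceptance
    (∀ u : List M.Letter, u ≠ [] → ∃ n : ℕ, M.autA.behaviour u = (n : WithBot ℕ)) ∧
    (∀ m : ℕ, ¬ M.Accepts m ↔
      ∀ u ∈ M.CTreg, M.IsMaxInit m u →
        ∃ n : ℕ, M.autA.behaviour u = (n : WithBot ℕ) ∧ (u.length : ℚ) / 2 < n) ∧
    -- the behaviour of `A_M`
    (∀ u : List M.Letter, u ≠ [] →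
      M.autAM.behaviour u = max ((u.length / 2 + 1 : ℕ) : WithBot ℕ) (M.autA.behaviour u)) ∧
    -- the behaviour of `B_M`
    (∀ x : List (Option M.Letter × Option M.Letter), x ≠ [] →
      (∀ (u : List M.Letter) (m : ℕ), u ≠ [] → x = convolution u (M.initWord m) →
        (u ∈ M.CTreg ∧ M.IsMaxInit m u → M.autBM.behaviour x = M.autA.behaviour u) ∧
        (u ∉ M.CTreg ∨ ¬ M.IsMaxInit m u → M.autBM.behaviour x = M.autAM.behaviour u)) ∧
      ((¬ ∃ (u : List M.Letter) (m : ℕ), u ≠ [] ∧ x = convolution u (M.initWord m)) →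
        M.autBM.behaviour x = 0)) ∧
    -- `r_{M,m}` takes values in `ℕ`
    (∀ (m : ℕ) (u : List M.Letter), u ≠ [] → ∃ n : ℕ, M.r m u = (n : WithBot ℕ)) ∧
    -- the equivalence
    (∀ m : ℕ, ¬ M.Accepts m ↔
      ∀ u : List M.Letter, u ≠ [] → M.autAM.behaviour u = M.r m u) := by
  refine ⟨⟨M.CTState, inferInstance, M.ctDFA, rfl⟩,
    fun _ hu => M.exists_ne_nil_eq_boxed_of_mem_CTreg hu,
    fun _ hu => M.exists_autA_behaviour_eq_coe hu, fun _ => M.not_accepts_iff,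
    fun _ hu => M.autAM_behaviour hu, fun x hx => ⟨?_, M.autBM_behaviour_of_not_valid hx⟩,
    fun m _ hu => M.exists_r_eq_coe m hu, fun _ => M.not_accepts_iff_behaviour_eq⟩
  rintro u m hu rfl
  exact ⟨M.autBM_behaviour_of_trace hu,
    fun h => M.autBM_behaviour_of_not_trace hu (not_and_or.2 h)⟩
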